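/- Let $\Delta_1,\dots,\Delta_m\subseteq\{1,\dots,n\}$ ($m\ge 1$) with $\Delta_1\cup\dots\cup\Delta_m=\{1,\dots,n\}$, let $f_i\in\mathbb R[x_{\Delta_i}]$ be real polynomials in the subvectors $x_{\Delta_i}=(x_j)_{j\in\Delta_i}$, and let $A\in\mathbb R^{m_1\times n}$, $b\in\mathbb R^{m_1}$, $C\in\mathbb R^{m_2\times n}$, $d\in\mathbb R^{m_2}$. Consider the problem $$\text{(P)}\qquad f_{\min}=\inf\Big\{f(x)=\sum_{i=1}^m f_i(x_{\Delta_i}) \;:\; Ax=b,\ Cx\ge d,\ x\ge 0\Big\}.$$ Let $k_0=\lceil \deg(f)/2\rceil$ and $g(x;\lambda,\mu)=\lambda^T(Ax-b)+\mu^T(Cx-d)$. Let $\Sigma[x_{\Delta_i}]_{t}$ be the set of sums of squares in $\mathbb R[x_{\Delta_i}]$ of degree at most $t$ (only $0$ if $t<0$), and put $$\mathrm{QM}[x]_{spa,2k}=\sum_{i=1}^m\Big(\Sigma[x_{\Delta_i}]_{2k}+\sum_{j\in\Delta_i}x_j\,\Sigma[x_{\Delta_i}]_{2k-2}\Big).$$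 Let $\mathbb U_k$ be the set of $\alpha\in\mathbb N^n$ with $|\alpha|\le 2k$ whose support lies in some $\Delta_i$. For $y\in\mathbb R^{\mathbb U_k}$ let $y_{\Delta_i}$ be the subvector of labels supported in $\Delta_i$, let $\langle p,y_{\Delta_i}\rangle=\sum_\alpha p_\alpha y_\alpha$ for $p=\sum_\alpha p_\alpha x^\alpha\in\mathbb R[x_{\Delta_i}]$ with $\deg p\le 2k$, and let $\pi(y)=(y_{e_1},\dots,y_{e_n})$. Let $f_k^{smo}$ be the optimal value of the sparse moment relaxation of order $k$, which minimizes $\sum_i\langle f_i,y_{\Delta_i}\rangle$ over $y\in\mathbb R^{\mathbb U_k}$ subject to $y_0=1$, $A\pi(y)=b$, $C\pi(y)\ge d$ and, for all $i$ and all $j\in\Delta_i$, $$\big(y_{\alpha+\beta}\big)_{|\alpha|,|\beta|\le k}\succeq 0,\qquad \big(y_{\alpha+\beta+e_j}\big)_{|\alpha|,|\beta|\le k-1}\succeq0\qquad(\alpha,\beta\in\mathbb N^{\Delta_i}).$$ Let $f_k^{spa}$ be the optimal value of the sparse SOS relaxation of order $k$, which maximizes $\gamma$ over $\gamma\in\mathbb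 R$, $\lambda\in\mathbb R^{m_1}$, $\mu\in\mathbb R^{m_2}_+$ subject to $f-g(x;\lambda,\mu)-\gamma\in\mathrm{QM}[x]_{spa,2k}$. Optimal values are taken in $[-\infty,+\infty]$. Call $p\in\mathbb R[x_{\Delta_i}]$ cop-SOS convex if $\nabla^2p=P_0P_0^T+\sum_{j\in\Delta_i}x_jP_jP_j^T$ for some matrix polynomials $P_0$, $P_j$ ($j\in\Delta_i$) in $x_{\Delta_i}$. **Theorem.** Suppose that every $f_i$ is cop-SOS convex, and let $k\ge\max\{k_0,1\}$. Then $f_k^{smo}=f_{\min}$, and if $y^*$ is an optimizer of the sparse moment relaxation of order $k$, then $\pi(y^*)$ is a minimizer of (P). If, in addition, (P) has a strictly feasible point (an $x$ with $Ax=b$, $Cx>d$, $x>0$), then $f_k^{spa}=f_{\min}$, and every optimizer $(\gamma^*,\lambda^*,\mu^*)$ of the sparse SOS relaxation of order $k$ satisfies $\gamma^*=f_{\min}$ and $$f-g(x;\lambda^*,\mu^*)-f_{\min}\in\mathrm{QM}[x]_{spa,2k_0}.$$ -/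

import Mathlib

namespace SparseCop

open MvPolynomial

noncomputable section

/-! ### Polynomials in a finite set of variables `σ` -/

section Block

variable {σ : Type*} [Fintype σ]

/-- The Hessian matrix polynomial `∇²p`. -/
def hessian (p : MvPolynomial σ ℝ) : Matrix σ σ (MvPolynomial σ ℝ) :=
  Matrix.of fun i j => pderiv i (pderiv j p)

/-- `p` is cop-SOS convex: `∇²p = P₀ P₀ᵀ + ∑ j, x_j P_j P_jᵀ` for matrix polynomials
`P₀` and `P_j` (each with any number of columns). -/
def IsCopSOSConvex (p : MvPolynomial σ ℝ) : Prop :=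
  ∃ (r₀ : ℕ) (P₀ : Matrix σ (Fin r₀) (MvPolynomial σ ℝ))
    (r : σ → ℕ) (P : ∀ j : σ, Matrix σ (Fin (r j)) (MvPolynomial σ ℝ)),
    hessian p = P₀ * P₀.transpose +
      ∑ j : σ, (X j : MvPolynomial σ ℝ) • (P j * (P j).transpose)

/-- The truncated quadratic module `Σ[x]_{2k} + ∑ j, x_j Σ[x]_{2k-2}` of the nonnegative
orthant.  The degree condition on the `s j` is written without subtraction, so that for
`k = 0` it forces `s j = 0`. -/
def qmodTrunc (σ : Type*) [Fintype σ] (k : ℕ) : Set (MvPolynomial σ ℝ) :=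
  {q | ∃ (s₀ : MvPolynomial σ ℝ) (s : σ → MvPolynomial σ ℝ),
    (IsSumSq s₀ ∧ s₀.totalDegree ≤ 2 * k) ∧
    (∀ j, IsSumSq (s j) ∧ (s j = 0 ∨ (s j).totalDegree + 2 ≤ 2 * k)) ∧
    q = s₀ + ∑ j, X j * s j}

/-- The power vectors `α` with `|α| ≤ t`. -/
abbrev Exps (σ : Type*) (t : ℕ) : Type _ := {α : σ →₀ ℕ // α.degree ≤ t}

/-- The Riesz functional `⟨p, z⟩ = ∑_α p_α z_α` of a truncated multi-sequence `z`, for `p` of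
degree at most `t` (monomials of higher degree are sent to `0`). -/
def riesz {t : ℕ} (z : Exps σ t → ℝ) (p : MvPolynomial σ ℝ) : ℝ :=
  ∑ α ∈ p.support, p.coeff α * (if h : α.degree ≤ t then z ⟨α, h⟩ else 0)

/-- The `k`th order localizing matrix of `p` at `z`: its rows and columns are labeled by the
monomials of degree at most `k - ⌈deg p / 2⌉`, its entries are `⟨p x^α x^β, z⟩`. -/
def localizingMatrix (p : MvPolynomial σ ℝ) (k : ℕ) (z : Exps σ (2 * k) → ℝ) :
    Matrix (Exps σ (k - (p.totalDegree + 1) / 2)) (Exps σ (k - (p.totalDegree + 1) / 2)) ℝ :=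
  Matrix.of fun α β => riesz z (p * (monomial α.1 1 * monomial β.1 1))

/-- The `k`th order moment matrix, with entries `z_{α+β}` for `|α|, |β| ≤ k`. -/
def momentMatrix (k : ℕ) (z : Exps σ (2 * k) → ℝ) : Matrix (Exps σ k) (Exps σ k) ℝ :=
  Matrix.of fun α β => z ⟨α.1 + β.1, by
    have hα := α.2
    have hβ := β.2
    rw [map_add]
    omega⟩

end Block

/-- The data of a sparse copositive polynomial optimization problem
`min f₁(x_{Δ₁}) + ⋯ + f_m(x_{Δ_m})` subject to `A x = b`, `C x ≥ d`, `x ≥ 0`,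
where the `Δ i` cover the set of variables. -/
structure Problem (n m m₁ m₂ : ℕ) where
  Δ : Fin m → Finset (Fin n)
  cover : ∀ j : Fin n, ∃ i : Fin m, j ∈ Δ i
  f : ∀ i : Fin m, MvPolynomial (Δ i) ℝ
  A : Matrix (Fin m₁) (Fin n) ℝ
  b : Fin m₁ → ℝ
  C : Matrix (Fin m₂) (Fin n) ℝ
  d : Fin m₂ → ℝ

namespace Problem

variable {n m m₁ m₂ : ℕ} (P : Problem n m m₁ m₂)

/-- A polynomial in the variables `x_{Δ i}`, seen as a polynomial in `x`. -/
def lift (i : Fin m) (p : MvPolynomial (P.Δ i) ℝ) : MvPolynomial (Fin n) ℝ :=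
  rename Subtype.val p

/-- The objective polynomial `f = f₁ + ⋯ + f_m`. -/
def objective : MvPolynomial (Fin n) ℝ := ∑ i, P.lift i (P.f i)

/-- The feasible set `K`. -/
def feasibleSet : Set (Fin n → ℝ) :=
  {x | P.A.mulVec x = P.b ∧ P.d ≤ P.C.mulVec x ∧ 0 ≤ x}

/-- `A x = b`, `C x > d` and `x > 0`, the inequalities being strict in every coordinate. -/
def IsStrictlyFeasible (x : Fin n → ℝ) : Prop :=
  P.A.mulVec x = P.b ∧ (∀ r, P.d r < P.C.mulVec x r) ∧ ∀ j, 0 < x j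

/-- `x` is a (global) minimizer of the problem. -/
def IsMinimizer (x : Fin n → ℝ) : Prop :=
  x ∈ P.feasibleSet ∧ IsMinOn (fun u => eval u P.objective) P.feasibleSet x

/-- The optimal value `f_min`, in the extended reals (`⊤` if the problem is infeasible). -/
def fmin : EReal := ⨅ x ∈ P.feasibleSet, ((eval x P.objective : ℝ) : EReal)

/-- `k₀ = ⌈deg f / 2⌉`. -/
def k₀ : ℕ := (P.objective.totalDegree + 1) / 2

/-! ### The sparse moment relaxation -/

/-- The label set `𝕌_k`, the union of the sets of power vectors supported in `Δ i` and of
degree at most `2k`. -/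
def labels (k : ℕ) : Set (Fin n →₀ ℕ) :=
  {α | ∃ i : Fin m, α.support ⊆ P.Δ i ∧ α.degree ≤ 2 * k}

open Classical in
/-- The entry `y_α` of `y ∈ ℝ^{𝕌_k}` (`0` for labels outside `𝕌_k`, which are never used when
`k ≥ 1` and `m ≥ 1`). -/
def entry {k : ℕ} (y : P.labels k → ℝ) (α : Fin n →₀ ℕ) : ℝ :=
  if h : α ∈ P.labels k then y ⟨α, h⟩ else 0

/-- The subvector `y_{Δ i}`. -/
def sub {k : ℕ} (y : P.labels k → ℝ) (i : Fin m) : Exps (P.Δ i) (2 * k) → ℝ :=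
  fun α => P.entry y (α.1.embDomain (Function.Embedding.subtype _))

/-- The projection `π(y) = (y_{e_1}, …, y_{e_n})`. -/
def proj {k : ℕ} (y : P.labels k → ℝ) : Fin n → ℝ :=
  fun j => P.entry y (Finsupp.single j 1)

/-- `⟨f, y⟩ = ⟨f₁, y_{Δ₁}⟩ + ⋯ + ⟨f_m, y_{Δ_m}⟩`. -/
def momentObjective {k : ℕ} (y : P.labels k → ℝ) : ℝ := ∑ i, riesz (P.sub y i) (P.f i)

/-- The feasible set of the `k`th order sparse moment relaxation.  Positive semidefiniteness
of the block diagonal localizing matrix of `x_{Δ i}` is stated block by block. -/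
def momentFeasibleSet (k : ℕ) : Set (P.labels k → ℝ) :=
  {y | P.A.mulVec (P.proj y) = P.b ∧ P.d ≤ P.C.mulVec (P.proj y) ∧
    (∀ i, (momentMatrix k (P.sub y i)).PosSemidef) ∧
    (∀ i, ∀ j : P.Δ i, (localizingMatrix (X j) k (P.sub y i)).PosSemidef) ∧
    P.entry y 0 = 1}

/-- `y` is an optimizer of the `k`th order sparse moment relaxation. -/
def IsMomentOptimizer (k : ℕ) (y : P.labels k → ℝ) : Prop :=
  y ∈ P.momentFeasibleSet k ∧ IsMinOn P.momentObjective (P.momentFeasibleSet k) y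

/-- The optimal value `f_k^{smo}` of the sparse moment relaxation, in the extended reals. -/
def fsmo (k : ℕ) : EReal := ⨅ y ∈ P.momentFeasibleSet k, ((P.momentObjective y : ℝ) : EReal)

/-! ### The sparse SOS relaxation -/

/-- `g(x; λ, μ) = λᵀ(A x - b) + μᵀ(C x - d)`, as a polynomial in `x`. -/
def g (lam : Fin m₁ → ℝ) (mu : Fin m₂ → ℝ) : MvPolynomial (Fin n) ℝ :=
  ∑ r, MvPolynomial.C (lam r) *
      (∑ j, MvPolynomial.C (P.A r j) * X j - MvPolynomial.C (P.b r)) +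
    ∑ r, MvPolynomial.C (mu r) *
      (∑ j, MvPolynomial.C (P.C r j) * X j - MvPolynomial.C (P.d r))

/-- The truncated sparse quadratic module `QM[x]_{spa,2k}`, the sum of the truncated quadratic
modules in the variables `x_{Δ i}`. -/
def sparseQmod (k : ℕ) : Set (MvPolynomial (Fin n) ℝ) :=
  {q | ∃ p : ∀ i : Fin m, MvPolynomial (P.Δ i) ℝ,
    (∀ i, p i ∈ qmodTrunc (P.Δ i) k) ∧ q = ∑ i, P.lift i (p i)}

/-- The triples `(γ, λ, μ)` that are feasible for the `k`th order sparse SOS relaxation. -/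
def sosFeasibleSet (k : ℕ) : Set (ℝ × (Fin m₁ → ℝ) × (Fin m₂ → ℝ)) :=
  {w | 0 ≤ w.2.2 ∧
    P.objective - P.g w.2.1 w.2.2 - MvPolynomial.C w.1 ∈ P.sparseQmod k}

/-- `w = (γ, λ, μ)` is an optimizer of the `k`th order sparse SOS relaxation. -/
def IsSOSOptimizer (k : ℕ) (w : ℝ × (Fin m₁ → ℝ) × (Fin m₂ → ℝ)) : Prop :=
  w ∈ P.sosFeasibleSet k ∧ IsMaxOn (fun v => v.1) (P.sosFeasibleSet k) w

/-- The optimal value `f_k^{spa}` of the sparse SOS relaxation, in the extended reals. -/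
def fspa (k : ℕ) : EReal := ⨆ w ∈ P.sosFeasibleSet k, ((w.1 : ℝ) : EReal)

end Problem

end

end SparseCop

/-! The core is a Taylor certificate. For `u ≥ 0` and `p` cop-SOS convex, `p(x) - p(u) - ∇p(u)ᵀ(x -
u)` equals `∫₀¹ (1 - s) (x - u)ᵀ ∇²p(u + s(x - u)) (x - u) ds`. Along the segment each weight `x_j`
becomes `(1 - s) u_j + s x_j`, with coefficients nonnegative on `[0, 1]`. Integrating squares
against such weights gives sums of squares, so the remainder lies in the quadratic module of the
orthant (`taylorRem_mem_qmod`).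

Degree bounds come from positivity: polynomials nonnegative on the orthant cannot cancel leading
forms (`OrthantNonneg.totalDegree_le_add`). A member of the untruncated sparse module of degree at
most `2k` is therefore in the truncated one, and the degree of `f` controls each block even though
the `f_i` are only given through their sum.

Moment side: a feasible `y` is nonnegative on the truncated module. Applied to the remainders at `u
= π(y)`, this is a Jensen inequality `f(π(y)) ≤ ⟨f, y⟩`, with `π(y)` feasible for (P). Point masses
give the reverse comparison of values.

SOS side: if `f_min` is finite it is attained, by a Frank–Wolfe argument for convex polynomials on
polyhedra. The constraints are linear, so Farkas' lemma yields multipliers at a minimizer `u`, and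
`f - g - f_min` is the Taylor remainder at `u` plus `∑ ν_j x_j` with `ν ≥ 0`. Strict feasibility
supplies a feasible point, and settles the bound `2k₀` when `f` is constant. -/

namespace SparseCop

open MvPolynomial Filter Topology

/-! ### Polynomials that are nonnegative on the orthant -/

section Degree

variable {σ : Type*}

/-- `p` takes nonnegative values on the nonnegative orthant. -/
def OrthantNonneg (p : MvPolynomial σ ℝ) : Prop := ∀ x : σ → ℝ, 0 ≤ x → 0 ≤ eval x p

theorem OrthantNonneg.add {p q : MvPolynomial σ ℝ} (hp : OrthantNonneg p)
    (hq : OrthantNonneg q) : OrthantNonneg (p + q) := fun x hx => by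
  rw [map_add]; exact add_nonneg (hp x hx) (hq x hx)

theorem OrthantNonneg.sum {ι : Type*} {s : Finset ι} {p : ι → MvPolynomial σ ℝ}
    (hp : ∀ i ∈ s, OrthantNonneg (p i)) : OrthantNonneg (∑ i ∈ s, p i) := fun x hx => by
  rw [map_sum]; exact Finset.sum_nonneg fun i hi => hp i hi x hx

theorem _root_.IsSumSq.orthantNonneg {s : MvPolynomial σ ℝ} (hs : IsSumSq s) :
    OrthantNonneg s := fun x _ => by
  induction hs with
  | zero => simp
  | sq_add a _ ih => rw [map_add, map_mul]; exact add_nonneg (mul_self_nonneg _) ih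

theorem OrthantNonneg.X_mul {p : MvPolynomial σ ℝ} (hp : OrthantNonneg p) (j : σ) :
    OrthantNonneg (X j * p) := fun x hx => by
  rw [map_mul, eval_X]; exact mul_nonneg (hx j) (hp x hx)

/-- The univariate polynomial `t ↦ p (t x)`. -/
noncomputable def rayRestrict (x : σ → ℝ) (p : MvPolynomial σ ℝ) : Polynomial ℝ :=
  ∑ i ∈ Finset.range (p.totalDegree + 1),
    Polynomial.monomial i (eval x (homogeneousComponent i p))

theorem eval_smul_of_isHomogeneous {p : MvPolynomial σ ℝ} {d : ℕ} (hp : p.IsHomogeneous d)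
    (t : ℝ) (x : σ → ℝ) : eval (t • x) p = t ^ d * eval x p := by
  rw [eval_eq, eval_eq, Finset.mul_sum]
  refine Finset.sum_congr rfl fun α hα => ?_
  have h : ∑ i ∈ α.support, α i = d := by
    have := hp (mem_support_iff.mp hα)
    simpa [Finsupp.weight_apply, Finsupp.sum] using this
  simp only [Pi.smul_apply, smul_eq_mul, mul_pow, Finset.prod_mul_distrib]
  rw [Finset.prod_pow_eq_pow_sum, h]
  ring

theorem eval_rayRestrict (x : σ → ℝ) (p : MvPolynomial σ ℝ) (t : ℝ) :
    (rayRestrict x p).eval t = eval (t • x) p := by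
  conv_rhs => rw [← sum_homogeneousComponent p]
  rw [rayRestrict, Polynomial.eval_finsetSum, map_sum]
  refine Finset.sum_congr rfl fun i _ => ?_
  rw [Polynomial.eval_monomial,
    eval_smul_of_isHomogeneous (homogeneousComponent_isHomogeneous i p), mul_comm]

theorem coeff_rayRestrict (x : σ → ℝ) (p : MvPolynomial σ ℝ) (d : ℕ) :
    (rayRestrict x p).coeff d = eval x (homogeneousComponent d p) := by
  rw [rayRestrict, Polynomial.finsetSum_coeff]
  simp only [Polynomial.coeff_monomial, Finset.sum_ite_eq', Finset.mem_range]
  split_ifs with h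
  · rfl
  · rw [homogeneousComponent_eq_zero _ _ (by omega), map_zero]

/-- Otherwise `q / p → 0`, while `p ≤ q` and `p > 0` for large `t` (a nonzero `p` has no roots far
out). -/
theorem degree_le_of_eventually_le {p q : Polynomial ℝ}
    (h0 : ∀ᶠ t in atTop, 0 ≤ p.eval t) (h : ∀ᶠ t in atTop, p.eval t ≤ q.eval t) :
    p.degree ≤ q.degree := by
  by_contra! hlt
  have hp : p ≠ 0 := by rintro rfl; simp at hlt
  have h1 := Polynomial.div_tendsto_atTop_zero_of_degree_lt q p hlt
  have h2 : ∀ᶠ t in atTop, p.eval t ≠ 0 := by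
    have := p.roots.toFinset.finite_toSet.bddAbove
    obtain ⟨B, hB⟩ := this
    filter_upwards [eventually_gt_atTop B] with t ht h0
    exact absurd (hB (by simpa [hp] using h0)) (not_le.mpr ht)
  obtain ⟨t, h0, h, h1, h2⟩ := (h0.and (h.and ((h1.eventually (gt_mem_nhds one_pos)).and h2))).exists
  have hpos : 0 < p.eval t := lt_of_le_of_ne h0 (Ne.symm h2)
  rw [div_lt_one hpos] at h1
  linarith

theorem eq_of_eval_eq_on_orthant [Finite σ] {p q : MvPolynomial σ ℝ}
    (h : ∀ x : σ → ℝ, 0 ≤ x → eval x p = eval x q) : p = q :=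
  funext_set (fun _ => Set.Ici 0) (fun _ => Set.Ici_infinite 0) fun x hx =>
    h x fun i => hx i (Set.mem_univ i)

/-- Polynomials that are nonnegative on the orthant cannot cancel in degree. -/
theorem OrthantNonneg.totalDegree_le_add [Finite σ] {p q : MvPolynomial σ ℝ}
    (hp : OrthantNonneg p) (hq : OrthantNonneg q) : p.totalDegree ≤ (p + q).totalDegree := by
  by_contra! hlt
  -- Along a ray of the orthant `0 ≤ p ≤ p + q`, so the restriction of `p` has degree below `deg p`.
  -- Its coefficient there is the top form of `p`, which thus vanishes on the orthant.
  have hzero : homogeneousComponent p.totalDegree p = 0 := by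
    refine eq_of_eval_eq_on_orthant fun x hx => ?_
    have hle : (rayRestrict x p).degree ≤ (rayRestrict x (p + q)).degree := by
      refine degree_le_of_eventually_le ?_ ?_ <;>
        filter_upwards [eventually_ge_atTop 0] with t ht
      · rw [eval_rayRestrict]; exact hp _ (smul_nonneg ht hx)
      · rw [eval_rayRestrict, eval_rayRestrict, map_add]
        linarith [hq _ (smul_nonneg ht hx)]
    have hdeg : (rayRestrict x (p + q)).degree < p.totalDegree := by
      rw [Polynomial.degree_lt_iff_coeff_zero]
      intro m hm
      rw [coeff_rayRestrict, homogeneousComponent_eq_zero _ _ (by omega), map_zero]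
    rw [← coeff_rayRestrict, map_zero]
    exact Polynomial.coeff_eq_zero_of_degree_lt (hle.trans_lt hdeg)
  have hpne : p ≠ 0 := by rintro rfl; simp at hlt
  obtain ⟨α, hα, hd⟩ := Finset.exists_mem_eq_sup p.support (support_nonempty.mpr hpne)
    (fun s => s.degree)
  have hd' : α.degree = p.totalDegree := by
    rw [← hd]; rfl
  have := congrArg (coeff α) hzero
  rw [coeff_homogeneousComponent, if_pos hd', coeff_zero] at this
  exact mem_support_iff.mp hα this

theorem OrthantNonneg.totalDegree_le_sum [Finite σ] {ι : Type*} {s : Finset ι}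
    {p : ι → MvPolynomial σ ℝ} (hp : ∀ i ∈ s, OrthantNonneg (p i)) {i : ι} (hi : i ∈ s) :
    (p i).totalDegree ≤ (∑ i ∈ s, p i).totalDegree := by
  classical
  rw [← Finset.add_sum_erase s p hi]
  exact (hp i hi).totalDegree_le_add (.sum fun j hj => hp j (Finset.mem_of_mem_erase hj))

theorem orthantNonneg_mul_self (a : MvPolynomial σ ℝ) : OrthantNonneg (a * a) :=
  (IsSumSq.mul_self a).orthantNonneg

theorem totalDegree_mul_self (a : MvPolynomial σ ℝ) :
    (a * a).totalDegree = 2 * a.totalDegree := by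
  by_cases h : a = 0
  · simp [h]
  · rw [totalDegree_mul_of_isDomain h h, two_mul]

/-- Without cancellation, the degree of a sum is the maximum of the degrees, and squares have even
degree. -/
theorem _root_.IsSumSq.even_totalDegree [Finite σ] {s : MvPolynomial σ ℝ} (hs : IsSumSq s) :
    Even s.totalDegree := by
  induction hs with
  | zero => simp
  | @sq_add a s hs ih =>
    have h1 := (orthantNonneg_mul_self a).totalDegree_le_add hs.orthantNonneg
    have h2 := hs.orthantNonneg.totalDegree_le_add (orthantNonneg_mul_self a)
    rw [add_comm s] at h2
    have h3 := totalDegree_add (a * a) s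
    rcases le_total (a * a).totalDegree s.totalDegree with h | h
    · rwa [le_antisymm (h3.trans (by simp [h])) h2]
    · rw [le_antisymm (h3.trans (by simp [h])) h1, totalDegree_mul_self]
      simp

/-- An induction principle in which every squared polynomial has degree at most `k`, as matrices
indexed by monomials of degree at most `k` require. -/
theorem _root_.IsSumSq.of_two_mul_totalDegree_le [Finite σ] {k : ℕ}
    {motive : MvPolynomial σ ℝ → Prop} (zero : motive 0)
    (sq_add : ∀ a s, a.totalDegree ≤ k → motive s → motive (a * a + s))
    {s : MvPolynomial σ ℝ} (hs : IsSumSq s) (hd : s.totalDegree ≤ 2 * k) : motive s := by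
  induction hs with
  | zero => exact zero
  | @sq_add a s hs ih =>
    have h1 := (orthantNonneg_mul_self a).totalDegree_le_add hs.orthantNonneg
    have h2 := hs.orthantNonneg.totalDegree_le_add (orthantNonneg_mul_self a)
    rw [add_comm s] at h2
    rw [totalDegree_mul_self] at h1
    exact sq_add a s (by omega) (ih (by omega))

end Degree

/-! ### The quadratic module of the orthant -/

section Qmod

variable {σ : Type*} [Fintype σ]

/-- The quadratic module of the nonnegative orthant, without degree bounds. -/
def qmod (σ : Type*) [Fintype σ] : Set (MvPolynomial σ ℝ) :=
  {q | ∃ (s₀ : MvPolynomial σ ℝ) (s : σ → MvPolynomial σ ℝ),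
    IsSumSq s₀ ∧ (∀ j, IsSumSq (s j)) ∧ q = s₀ + ∑ j, X j * s j}

theorem orthantNonneg_of_mem_qmod {q : MvPolynomial σ ℝ} (hq : q ∈ qmod σ) :
    OrthantNonneg q := by
  obtain ⟨s₀, s, h0, h, rfl⟩ := hq
  exact h0.orthantNonneg.add (.sum fun j _ => (h j).orthantNonneg.X_mul j)

/-- All summands are nonnegative on the orthant, so none exceeds the degree of `q`. -/
theorem mem_qmodTrunc_of_mem_qmod {q : MvPolynomial σ ℝ} (hq : q ∈ qmod σ) {k : ℕ}
    (hk : q.totalDegree ≤ 2 * k) : q ∈ qmodTrunc σ k := by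
  obtain ⟨s₀, s, h0, h, rfl⟩ := hq
  have hX : ∀ j ∈ Finset.univ, OrthantNonneg (X j * s j) :=
    fun j _ => (h j).orthantNonneg.X_mul j
  refine ⟨s₀, s, ⟨h0, (h0.orthantNonneg.totalDegree_le_add (.sum hX)).trans hk⟩,
    fun j => ⟨h j, ?_⟩, rfl⟩
  by_cases hj : s j = 0
  · exact .inl hj
  right
  have h1 := OrthantNonneg.totalDegree_le_sum hX (Finset.mem_univ j)
  have h2 := (OrthantNonneg.sum hX).totalDegree_le_add h0.orthantNonneg
  rw [add_comm _ s₀] at h2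
  rw [totalDegree_mul_of_isDomain (X_ne_zero j) hj, totalDegree_X] at h1
  -- The bound on `x_j s_j` only gives `deg s_j ≤ 2k - 1`; parity improves it to `2k - 2`.
  obtain ⟨r, hr⟩ := (h j).even_totalDegree
  omega

theorem mem_qmod_of_mem_qmodTrunc {q : MvPolynomial σ ℝ} {k : ℕ} (hq : q ∈ qmodTrunc σ k) :
    q ∈ qmod σ := by
  obtain ⟨s₀, s, h0, h, rfl⟩ := hq
  exact ⟨s₀, s, h0.1, fun j => (h j).1, rfl⟩

theorem zero_mem_qmod : (0 : MvPolynomial σ ℝ) ∈ qmod σ :=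
  ⟨0, 0, .zero, fun _ => .zero, by simp⟩

theorem add_mem_qmod {p q : MvPolynomial σ ℝ} (hp : p ∈ qmod σ) (hq : q ∈ qmod σ) :
    p + q ∈ qmod σ := by
  obtain ⟨s₀, s, h0, h, rfl⟩ := hp
  obtain ⟨s₀', s', h0', h', rfl⟩ := hq
  refine ⟨s₀ + s₀', s + s', h0.add h0', fun j => (h j).add (h' j), ?_⟩
  simp only [Pi.add_apply, mul_add, Finset.sum_add_distrib]
  ring

theorem isSumSq_C {σ : Type*} {a : ℝ} (ha : 0 ≤ a) : IsSumSq (C a : MvPolynomial σ ℝ) := by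
  rw [← Real.mul_self_sqrt ha, C_mul]
  exact IsSumSq.mul_self _

end Qmod

theorem sum_sum_mul_gram {R ι κ : Type*} [CommRing R] [Fintype ι] [Fintype κ] (d : ι → R)
    (Q : ι → κ → R) :
    ∑ i, ∑ j, d i * d j * ∑ l, Q i l * Q j l =
      ∑ l, (∑ i, d i * Q i l) * (∑ i, d i * Q i l) := by
  simp only [Finset.sum_mul_sum]
  rw [Finset.sum_comm (γ := κ)]
  refine Finset.sum_congr rfl fun i _ => ?_
  rw [Finset.sum_comm (γ := κ)]
  refine Finset.sum_congr rfl fun j _ => ?_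
  rw [Finset.mul_sum]
  exact Finset.sum_congr rfl fun l _ => by ring

/-! ### Coefficientwise extension of functionals on real univariate polynomials -/

section Extend

variable {A : Type*} [CommRing A] [Algebra ℝ A]

/-- The `A`-linear map `A[X] → A` that agrees with `ℓ` on the powers of `X`. -/
noncomputable def extend (ℓ : Polynomial ℝ →ₗ[ℝ] ℝ) : Polynomial A →ₗ[A] A :=
  Polynomial.lsum fun a => algebraMap ℝ A (ℓ (Polynomial.X ^ a)) • LinearMap.id

theorem extend_monomial (ℓ : Polynomial ℝ →ₗ[ℝ] ℝ) (a : ℕ) (c : A) :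
    extend ℓ (Polynomial.monomial a c) = algebraMap ℝ A (ℓ (Polynomial.X ^ a)) * c := by
  simp [extend, Polynomial.lsum_apply, Algebra.smul_def]

theorem extend_map_mul (ℓ : Polynomial ℝ →ₗ[ℝ] ℝ) (w : Polynomial ℝ) (q : Polynomial A) :
    extend ℓ (w.map (algebraMap ℝ A) * q) = extend (ℓ ∘ₗ LinearMap.mulLeft ℝ w) q := by
  induction q using Polynomial.induction_on' with
  | add p q hp hq => rw [mul_add, map_add, map_add, hp, hq]
  | monomial a c =>
    induction w using Polynomial.induction_on' with
    | add v w hv hw =>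
      rw [Polynomial.map_add, add_mul, map_add, hv, hw]
      simp only [extend_monomial, LinearMap.comp_apply, LinearMap.mulLeft_apply, add_mul, map_add]
    | monomial b r =>
      rw [Polynomial.map_monomial, Polynomial.monomial_mul_monomial, extend_monomial,
        extend_monomial, LinearMap.comp_apply, LinearMap.mulLeft_apply,
        ← Polynomial.C_mul_X_pow_eq_monomial, mul_assoc, ← pow_add, ← Polynomial.smul_eq_C_mul,
        map_smul, smul_eq_mul, map_mul]
      ring

/-- The Hankel matrix `ℓ(X^(a+b))` is positive semidefinite, hence `∑ i, vᵢ vᵢᵀ`; then the value at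
`q²` is `∑ i, (∑ a, vᵢ(a) q_a)²` in `A`. -/
theorem isSumSq_extend_mul_self {ℓ : Polynomial ℝ →ₗ[ℝ] ℝ} (hℓ : ∀ p, 0 ≤ ℓ (p * p))
    (q : Polynomial A) : IsSumSq (extend ℓ (q * q)) := by
  set N := q.natDegree + 1
  let M : Matrix (Fin N) (Fin N) ℝ := Matrix.of fun a b => ℓ (Polynomial.X ^ (a.1 + b.1))
  have hM : M.PosSemidef := by
    refine .of_dotProduct_mulVec_nonneg ?_ fun x => ?_
    · ext a b; simp [M, add_comm]
    · have h := hℓ (∑ a : Fin N, x a • Polynomial.X ^ a.1)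
      rw [Finset.sum_mul_sum, map_sum] at h
      refine h.trans_eq ?_
      rw [dotProduct]
      refine Finset.sum_congr rfl fun a _ => ?_
      rw [map_sum, Matrix.mulVec, dotProduct, Finset.mul_sum]
      refine Finset.sum_congr rfl fun b _ => ?_
      rw [smul_mul_smul_comm, ← pow_add, map_smul]
      simp only [star_trivial, M, Matrix.of_apply, smul_eq_mul]
      ring
  obtain ⟨r, v, hv⟩ := Matrix.posSemidef_iff_eq_sum_vecMulVec.mp hM
  have hentry : ∀ a b : Fin N, ℓ (Polynomial.X ^ (a.1 + b.1)) = ∑ i, v i a * v i b := by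
    intro a b
    have := congrFun (congrFun hv a) b
    simpa [M, Matrix.sum_apply, Matrix.vecMulVec_apply] using this
  have hq : q = ∑ a : Fin N, Polynomial.monomial a.1 (q.coeff a) := by
    conv_lhs => rw [q.as_sum_range]
    rw [Finset.sum_range]
  have key : extend ℓ (q * q) =
      ∑ i, (∑ a : Fin N, q.coeff a * algebraMap ℝ A (v i a)) *
        (∑ a : Fin N, q.coeff a * algebraMap ℝ A (v i a)) := by
    rw [← sum_sum_mul_gram (fun a : Fin N => q.coeff a) fun a i => algebraMap ℝ A (v i a)]
    conv_lhs => rw [hq, Finset.sum_mul_sum, map_sum]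
    refine Finset.sum_congr rfl fun a _ => ?_
    rw [map_sum]
    refine Finset.sum_congr rfl fun b _ => ?_
    rw [Polynomial.monomial_mul_monomial, extend_monomial, hentry, map_sum, mul_comm]
    simp only [map_mul]
  rw [key]
  exact IsSumSq.sum_mul_self _ _

end Extend

/-! ### Taylor's formula with integral remainder, formally -/

/-- `p ↦ ∫₀¹ (1 - s) p(s) ds`. -/
noncomputable def taylorIntegral : Polynomial ℝ →ₗ[ℝ] ℝ where
  toFun p := ∫ s in (0 : ℝ)..1, (1 - s) * p.eval s
  map_add' p q := by
    simp only [Polynomial.eval_add, mul_add]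
    exact intervalIntegral.integral_add
      (Continuous.intervalIntegrable (by fun_prop) _ _)
      (Continuous.intervalIntegrable (by fun_prop) _ _)
  map_smul' c p := by
    simp only [Polynomial.eval_smul, smul_eq_mul, RingHom.id_apply]
    rw [← intervalIntegral.integral_const_mul]
    congr 1; ext s; ring

theorem taylorIntegral_X_pow (a : ℕ) :
    taylorIntegral (Polynomial.X ^ a) = 1 / ((a + 1) * (a + 2)) := by
  change ∫ s in (0 : ℝ)..1, (1 - s) * (Polynomial.X ^ a).eval s = _
  have : ∀ s : ℝ, (1 - s) * ((Polynomial.X : Polynomial ℝ) ^ a).eval s = s ^ a - s ^ (a + 1) := by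
    intro s; simp; ring
  simp only [this]
  rw [intervalIntegral.integral_sub (Continuous.intervalIntegrable (by fun_prop) _ _)
    (Continuous.intervalIntegrable (by fun_prop) _ _), integral_pow, integral_pow]
  have h1 : (a : ℝ) + 1 ≠ 0 := by positivity
  have h2 : (a : ℝ) + 2 ≠ 0 := by positivity
  have h3 : (a : ℝ) + 1 + 1 ≠ 0 := by positivity
  push_cast
  field_simp
  ring

theorem taylorIntegral_mul_nonneg {w : Polynomial ℝ}
    (hw : ∀ s : ℝ, 0 ≤ s → s ≤ 1 → 0 ≤ w.eval s) (p : Polynomial ℝ) :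
    0 ≤ (taylorIntegral ∘ₗ LinearMap.mulLeft ℝ w) (p * p) := by
  change 0 ≤ ∫ s in (0 : ℝ)..1, (1 - s) * (w * (p * p)).eval s
  refine intervalIntegral.integral_nonneg zero_le_one fun s hs => ?_
  rw [Polynomial.eval_mul, Polynomial.eval_mul]
  exact mul_nonneg (sub_nonneg.mpr hs.2) (mul_nonneg (hw s hs.1 hs.2) (mul_self_nonneg _))

/-- Checked on monomials: two derivatives produce exactly the factor that `∫ (1 - s) s^a ds = 1 /
((a + 1)(a + 2))` removes. In degrees 0 and 1 both sides vanish. -/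
theorem extend_taylorIntegral_derivative {A : Type*} [CommRing A] [Algebra ℝ A]
    (q : Polynomial A) :
    extend taylorIntegral (Polynomial.derivative (Polynomial.derivative q)) =
      q.eval 1 - q.eval 0 - (Polynomial.derivative q).eval 0 := by
  induction q using Polynomial.induction_on' with
  | add p q hp hq => simp only [map_add, Polynomial.eval_add, hp, hq]; ring
  | monomial a c =>
    rcases a with _ | _ | a
    · simp
    · simp
    · rw [Polynomial.derivative_monomial, Polynomial.derivative_monomial, extend_monomial,
        taylorIntegral_X_pow]
      simp only [Polynomial.eval_monomial]
      have h : algebraMap ℝ A (1 / (((a + 1 + 1 - 1 - 1 : ℕ) + 1) * ((a + 1 + 1 - 1 - 1 : ℕ) + 2))) *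
          ((a + 1 + 1 : ℕ) * (a + 1 + 1 - 1 : ℕ)) = 1 := by
        rw [← map_natCast (algebraMap ℝ A), ← map_natCast (algebraMap ℝ A), ← map_mul, ← map_mul,
          ← map_one (algebraMap ℝ A)]
        congr 1
        simp only [Nat.add_sub_cancel]
        push_cast
        have h1 : (a : ℝ) + 1 ≠ 0 := by positivity
        have h2 : (a : ℝ) + 2 ≠ 0 := by positivity
        field_simp
        ring
      simp only [one_pow, mul_one, Nat.add_sub_cancel] at h ⊢
      simp only [ne_eq, Nat.add_eq_zero_iff, one_ne_zero, and_false, not_false_eq_true, zero_pow,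
        mul_zero, sub_zero]
      linear_combination c * h

section Taylor

variable {σ : Type*} {A : Type*} [CommRing A] [Algebra ℝ A]

/-- The polynomial `s ↦ p (a + s b)`. -/
noncomputable def segmentPoly (a b : σ → A) : MvPolynomial σ ℝ →ₐ[ℝ] Polynomial A :=
  aeval fun j => Polynomial.C (a j) + Polynomial.X * Polynomial.C (b j)

theorem segmentPoly_X (a b : σ → A) (j : σ) : segmentPoly a b (X j) =
    Polynomial.C (a j) + Polynomial.X * Polynomial.C (b j) := by
  simp [segmentPoly]

theorem segmentPoly_C (a b : σ → A) (r : ℝ) :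
    segmentPoly a b (C r) = Polynomial.C (algebraMap ℝ A r) := by
  simp only [segmentPoly, algHom_C]
  rfl

theorem eval_segmentPoly (a b : σ → A) (p : MvPolynomial σ ℝ) (t : A) :
    (segmentPoly a b p).eval t = aeval (fun j => a j + t * b j) p := by
  induction p using MvPolynomial.induction_on with
  | C r => rw [segmentPoly_C, Polynomial.eval_C, algHom_C]
  | add p q hp hq => simp only [map_add, Polynomial.eval_add, hp, hq]
  | mul_X p n hp =>
    simp only [map_mul, Polynomial.eval_mul, hp, segmentPoly_X, Polynomial.eval_add,
      Polynomial.eval_C, Polynomial.eval_X, aeval_X]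

theorem aeval_C_eq (u : σ → ℝ) (p : MvPolynomial σ ℝ) :
    aeval (fun j => (C (u j) : MvPolynomial σ ℝ)) p = C (eval u p) := by
  induction p using MvPolynomial.induction_on with
  | C r => simp only [algHom_C, eval_C]; rfl
  | add p q hp hq => simp only [map_add, hp, hq]
  | mul_X p n hp => simp only [map_mul, hp, aeval_X, eval_X]

variable [Fintype σ]

theorem derivative_segmentPoly (a b : σ → A) (p : MvPolynomial σ ℝ) :
    Polynomial.derivative (segmentPoly a b p) =
      ∑ j, Polynomial.C (b j) * segmentPoly a b (pderiv j p) := by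
  classical
  induction p using MvPolynomial.induction_on with
  | C r => simp
  | add p q hp hq => simp only [map_add, hp, hq, mul_add, Finset.sum_add_distrib]
  | mul_X p n hp =>
    rw [map_mul, Polynomial.derivative_mul, hp]
    have hX : Polynomial.derivative (segmentPoly a b (X n)) = Polynomial.C (b n) := by
      rw [segmentPoly_X]; simp
    simp only [pderiv_mul, pderiv_X, map_add, map_mul, mul_add, Finset.sum_add_distrib, hX,
      Finset.sum_mul]
    congr 1
    · exact Finset.sum_congr rfl fun _ _ => by ring
    · rw [Finset.sum_eq_single n]
      · simp only [Pi.single_eq_same, map_one, mul_one]; ring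
      · intro j _ hj; simp [hj]
      · simp

/-- The one-variable formula for `s ↦ p(a + s b)`. A general algebra `A` allows `a = u` and `b = x -
u` with `x` the indeterminates, so the outcome is a polynomial identity. -/
theorem aeval_add_eq_taylor (a b : σ → A) (p : MvPolynomial σ ℝ) :
    aeval (a + b) p - aeval a p - ∑ j, b j * aeval a (pderiv j p) = extend taylorIntegral
      (∑ i, ∑ j, Polynomial.C (b i * b j) * segmentPoly a b (pderiv i (pderiv j p))) := by
  have h2 : Polynomial.derivative (Polynomial.derivative (segmentPoly a b p)) =
      ∑ i, ∑ j, Polynomial.C (b i * b j) * segmentPoly a b (pderiv i (pderiv j p)) := by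
    rw [Finset.sum_comm, derivative_segmentPoly, map_sum]
    refine Finset.sum_congr rfl fun j _ => ?_
    rw [Polynomial.derivative_C_mul, derivative_segmentPoly, Finset.mul_sum]
    refine Finset.sum_congr rfl fun i _ => ?_
    rw [Polynomial.C_mul]; ring
  rw [← h2, extend_taylorIntegral_derivative, derivative_segmentPoly, Polynomial.eval_finsetSum]
  simp only [Polynomial.eval_mul, Polynomial.eval_C, eval_segmentPoly, one_mul, zero_mul,
    add_zero]
  rfl

/-- `p - p(u) - ∇p(u)ᵀ (x - u)`. -/
noncomputable def taylorRem (u : σ → ℝ) (p : MvPolynomial σ ℝ) : MvPolynomial σ ℝ :=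
  p - C (eval u p) - ∑ j, (X j - C (u j)) * C (eval u (pderiv j p))

theorem taylorRem_eq_extend (u : σ → ℝ) (p : MvPolynomial σ ℝ) :
    taylorRem u p = extend taylorIntegral
      (∑ i, ∑ j, Polynomial.C ((X i - C (u i)) * (X j - C (u j))) *
        segmentPoly (fun j => C (u j)) (fun j => X j - C (u j)) (pderiv i (pderiv j p))) := by
  have h := aeval_add_eq_taylor (fun j => (C (u j) : MvPolynomial σ ℝ))
    (fun j => X j - C (u j)) p
  have hadd : ((fun j => C (u j)) + fun j => X j - C (u j)) =
      (X : σ → MvPolynomial σ ℝ) := by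
    funext j; simp only [Pi.add_apply]; ring
  rw [hadd, aeval_X_left_apply] at h
  simp only [aeval_C_eq] at h
  exact h

/-- Makes the second-order vanishing at `u` explicit; the factors `x_i - u_i` are scalars for the
linear map `extend`. -/
theorem exists_taylorRem_eq_sum (u : σ → ℝ) (p : MvPolynomial σ ℝ) :
    ∃ h : σ → σ → MvPolynomial σ ℝ,
      taylorRem u p = ∑ i, ∑ j, (X i - C (u i)) * (X j - C (u j)) * h i j := by
  refine ⟨fun i j => extend taylorIntegral (segmentPoly (fun j => C (u j))
    (fun j => X j - C (u j)) (pderiv i (pderiv j p))), ?_⟩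
  rw [taylorRem_eq_extend]
  simp only [map_sum, ← Polynomial.smul_eq_C_mul, map_smul, smul_eq_mul]

/-- The Taylor remainder of a cop-SOS convex polynomial at a point of the orthant lies in the
quadratic module of the orthant. -/
theorem taylorRem_mem_qmod {u : σ → ℝ} (hu : 0 ≤ u) {p : MvPolynomial σ ℝ}
    (hp : IsCopSOSConvex p) : taylorRem u p ∈ qmod σ := by
  obtain ⟨r₀, P₀, r, P, hH⟩ := hp
  set φ : MvPolynomial σ ℝ →ₐ[ℝ] Polynomial (MvPolynomial σ ℝ) :=
    segmentPoly (fun j => C (u j)) (fun j => X j - C (u j)) with hφ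
  set d : σ → Polynomial (MvPolynomial σ ℝ) := fun i => Polynomial.C (X i - C (u i))
  have hentry : ∀ i j, φ (pderiv i (pderiv j p)) =
      ∑ l, φ (P₀ i l) * φ (P₀ j l) +
        ∑ m, φ (X m) *
          ∑ l, φ (P m i l) * φ (P m j l) := by
    intro i j
    have := congrFun (congrFun hH i) j
    simp only [hessian, Matrix.of_apply, Matrix.add_apply, Matrix.mul_apply,
      Matrix.transpose_apply, Matrix.sum_apply, Matrix.smul_apply, smul_eq_mul] at this
    rw [this]
    simp only [map_add, map_sum, map_mul]
  set q₀ := fun l => ∑ i, d i * φ (P₀ i l)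
  set q := fun m l => ∑ i, d i * φ (P m i l)
  have hsum : ∑ i, ∑ j, Polynomial.C ((X i - C (u i)) * (X j - C (u j))) *
        φ (pderiv i (pderiv j p)) =
      ∑ l, q₀ l * q₀ l + ∑ m, φ (X m) * ∑ l, q m l * q m l := by
    simp only [q₀, q, ← sum_sum_mul_gram, hentry, Polynomial.C_mul, mul_add,
      Finset.sum_add_distrib]
    congr 1
    symm
    simp only [Finset.mul_sum (s := (Finset.univ : Finset σ))]
    rw [Finset.sum_comm]
    refine Finset.sum_congr rfl fun i _ => ?_
    rw [Finset.sum_comm]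
    exact Finset.sum_congr rfl fun j _ => Finset.sum_congr rfl fun m _ => by ring
  -- The weight `x_m` on the segment is `(1 - s) u_m + s x_m`.
  have hX : ∀ m, φ (X m) =
      Polynomial.C (C (u m)) * (1 - Polynomial.X : Polynomial ℝ).map (algebraMap ℝ _) +
        Polynomial.C (X m) * (Polynomial.X : Polynomial ℝ).map (algebraMap ℝ _) := by
    intro m
    rw [segmentPoly_X]
    simp only [Polynomial.map_sub, Polynomial.map_one, Polynomial.map_X, Polynomial.C_sub]
    ring
  have hsos : ∀ w : Polynomial ℝ, (∀ s : ℝ, 0 ≤ s → s ≤ 1 → 0 ≤ w.eval s) →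
      ∀ {n : ℕ} (q : Fin n → Polynomial (MvPolynomial σ ℝ)),
      IsSumSq (extend taylorIntegral (w.map (algebraMap ℝ _) * ∑ l, q l * q l)) := by
    intro w hw n q
    rw [extend_map_mul, map_sum (extend _)]
    exact .sum fun l _ => isSumSq_extend_mul_self (taylorIntegral_mul_nonneg hw) _
  have hone := fun n => hsos 1 (by simp) (n := n)
  simp only [Polynomial.map_one, one_mul] at hone
  have h1X := fun n => hsos (1 - Polynomial.X) (by intro s _ hs; simpa using hs) (n := n)
  have hXX := fun n => hsos Polynomial.X (by intro s hs _; simpa using hs) (n := n)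
  rw [taylorRem_eq_extend, ← hφ, hsum]
  -- The part weighted by the constant `u_m ≥ 0` joins the free sum of squares; the part weighted by
  -- `x_m` becomes the multiplier of `x_m`.
  refine ⟨extend taylorIntegral (∑ l, q₀ l * q₀ l) + ∑ m, C (u m) * extend taylorIntegral
      ((1 - Polynomial.X : Polynomial ℝ).map (algebraMap ℝ _) * ∑ l, q m l * q m l),
    fun m => extend taylorIntegral
      ((Polynomial.X : Polynomial ℝ).map (algebraMap ℝ _) * ∑ l, q m l * q m l),
    (hone _ _).add (.sum fun m _ => (isSumSq_C (hu m)).mul (h1X _ _)),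
    fun m => hXX _ _, ?_⟩
  rw [map_add, map_sum (extend taylorIntegral) (fun m => φ (X m) * ∑ l, q m l * q m l),
    add_assoc, ← Finset.sum_add_distrib]
  congr 1
  refine Finset.sum_congr rfl fun m _ => ?_
  rw [hX, add_mul, map_add, mul_assoc, mul_assoc, ← Polynomial.smul_eq_C_mul,
    ← Polynomial.smul_eq_C_mul, map_smul, map_smul, smul_eq_mul, smul_eq_mul]

end Taylor

/-! ### The Riesz functional -/

section Riesz

variable {σ : Type*} {t : ℕ} (z : Exps σ t → ℝ)

theorem riesz_eq_sum {p : MvPolynomial σ ℝ} {S : Finset (σ →₀ ℕ)} (hS : p.support ⊆ S) :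
    riesz z p = ∑ α ∈ S, p.coeff α * (if h : α.degree ≤ t then z ⟨α, h⟩ else 0) :=
  Finset.sum_subset hS fun α _ hα => by rw [notMem_support_iff.mp hα, zero_mul]

/-- The Riesz functional as a linear map. -/
noncomputable def rieszLinear : MvPolynomial σ ℝ →ₗ[ℝ] ℝ where
  toFun := riesz z
  map_add' p q := by
    classical
    rw [riesz_eq_sum z (p := p + q) support_add,
      riesz_eq_sum z (p := p) (Finset.subset_union_left (s₂ := q.support)),
      riesz_eq_sum z (p := q) (Finset.subset_union_right (s₁ := p.support)),
      ← Finset.sum_add_distrib]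
    exact Finset.sum_congr rfl fun α _ => by rw [coeff_add, add_mul]
  map_smul' c p := by
    rw [riesz_eq_sum z (support_smul (a := c) (f := p)), RingHom.id_apply, smul_eq_mul, riesz,
      Finset.mul_sum]
    exact Finset.sum_congr rfl fun α _ => by rw [coeff_smul, smul_eq_mul, mul_assoc]

theorem rieszLinear_apply (p : MvPolynomial σ ℝ) : rieszLinear z p = riesz z p := rfl

theorem rieszLinear_monomial (α : σ →₀ ℕ) (c : ℝ) :
    rieszLinear z (monomial α c) = c * (if h : α.degree ≤ t then z ⟨α, h⟩ else 0) := by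
  classical
  rw [rieszLinear_apply, riesz_eq_sum z support_monomial_subset, Finset.sum_singleton,
    coeff_monomial, if_pos rfl]

theorem exists_linearCombination_monomial {p : MvPolynomial σ ℝ} {k : ℕ}
    (hp : p.totalDegree ≤ k) : ∃ c : Exps σ k →₀ ℝ,
      p = Finsupp.linearCombination ℝ (fun α : Exps σ k => monomial α.1 (1 : ℝ)) c := by
  have : p ∈ Submodule.span ℝ (Set.range fun α : Exps σ k => monomial α.1 (1 : ℝ)) := by
    rw [p.as_sum]
    refine Submodule.sum_mem _ fun α hα => ?_
    have hα' : α.degree ≤ k := (le_totalDegree hα).trans hp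
    rw [show monomial α (coeff α p) = coeff α p • monomial α (1 : ℝ) by
      rw [smul_monomial, smul_eq_mul, mul_one]]
    exact Submodule.smul_mem _ _ (Submodule.subset_span ⟨⟨α, hα'⟩, rfl⟩)
  rw [← Finsupp.range_linearCombination] at this
  obtain ⟨c, hc⟩ := this
  exact ⟨c, hc.symm⟩

/-- This value is the quadratic form of the matrix at the coefficient vector of `q`. -/
theorem rieszLinear_mul_mul_self_nonneg {k : ℕ} {w q : MvPolynomial σ ℝ}
    (hM : (Matrix.of fun α β : Exps σ k =>
      rieszLinear z (w * (monomial α.1 1 * monomial β.1 1))).PosSemidef)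
    (hq : q.totalDegree ≤ k) : 0 ≤ rieszLinear z (w * (q * q)) := by
  obtain ⟨c, rfl⟩ := exists_linearCombination_monomial hq
  refine (hM.2 c).trans_eq ?_
  simp only [Finsupp.linearCombination_apply, Finsupp.sum]
  rw [Finset.sum_mul_sum, Finset.mul_sum, map_sum]
  refine Finset.sum_congr rfl fun α _ => ?_
  rw [Finset.mul_sum, map_sum]
  refine Finset.sum_congr rfl fun β _ => ?_
  rw [smul_mul_smul_comm, mul_smul_comm, map_smul, Matrix.of_apply, star_trivial, smul_eq_mul]
  ring

theorem rieszLinear_sumSq_nonneg [Finite σ] {k : ℕ} {w s : MvPolynomial σ ℝ}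
    (hM : (Matrix.of fun α β : Exps σ k =>
      rieszLinear z (w * (monomial α.1 1 * monomial β.1 1))).PosSemidef)
    (hs : IsSumSq s) (hd : s.totalDegree ≤ 2 * k) : 0 ≤ rieszLinear z (w * s) := by
  refine hs.of_two_mul_totalDegree_le (motive := fun s => 0 ≤ rieszLinear z (w * s))
    (by simp) (fun a s ha ih => ?_) hd
  rw [mul_add, map_add]
  exact add_nonneg (rieszLinear_mul_mul_self_nonneg z hM ha) ih

theorem rieszLinear_momentMatrix {k : ℕ} (z : Exps σ (2 * k) → ℝ) :
    momentMatrix k z = Matrix.of fun α β : Exps σ k =>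
      rieszLinear z (1 * (monomial α.1 1 * monomial β.1 1)) := by
  ext α β
  have h : (α.1 + β.1).degree ≤ 2 * k := by
    rw [map_add]; linarith [α.2, β.2]
  rw [Matrix.of_apply, one_mul, monomial_mul, rieszLinear_monomial, dif_pos h]
  simp [momentMatrix]

theorem rieszLinear_localizingMatrix_posSemidef {k : ℕ} {z : Exps σ (2 * k) → ℝ} {j : σ}
    (h : (localizingMatrix (X j) k z).PosSemidef) :
    (Matrix.of fun α β : Exps σ (k - 1) =>
      rieszLinear z (X j * (monomial α.1 1 * monomial β.1 1))).PosSemidef := by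
  have hk : k - ((X j : MvPolynomial σ ℝ).totalDegree + 1) / 2 = k - 1 := by
    rw [totalDegree_X]
  rw [localizingMatrix] at h
  rw [hk] at h
  exact h

theorem rieszLinear_nonneg_of_mem_qmodTrunc [Fintype σ] {k : ℕ} {z : Exps σ (2 * k) → ℝ}
    (h0 : (momentMatrix k z).PosSemidef)
    (h : ∀ j : σ, (localizingMatrix (X j) k z).PosSemidef) {q : MvPolynomial σ ℝ}
    (hq : q ∈ qmodTrunc σ k) : 0 ≤ rieszLinear z q := by
  obtain ⟨s₀, s, hs0, hs, rfl⟩ := hq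
  rw [map_add, map_sum]
  refine add_nonneg ?_ (Finset.sum_nonneg fun j _ => ?_)
  · rw [rieszLinear_momentMatrix] at h0
    simpa only [one_mul] using rieszLinear_sumSq_nonneg z h0 hs0.1 hs0.2
  · rcases (hs j).2 with h2 | h2
    · simp [h2]
    · exact rieszLinear_sumSq_nonneg z (rieszLinear_localizingMatrix_posSemidef (h j)) (hs j).1
        (by omega)

theorem rieszLinear_C (c : ℝ) : rieszLinear z (C c) = c * z ⟨0, by simp⟩ := by
  rw [C_apply, rieszLinear_monomial, dif_pos (by simp)]

theorem rieszLinear_X (ht : 1 ≤ t) (j : σ) :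
    rieszLinear z (X j) = z ⟨Finsupp.single j 1, by simpa using ht⟩ := by
  rw [X, rieszLinear_monomial, dif_pos (by simpa using ht), one_mul]

/-- Jensen's inequality for cop-SOS convex polynomials and truncated moment sequences of the
orthant. -/
theorem eval_le_riesz [Fintype σ] {k : ℕ} {z : Exps σ (2 * k) → ℝ}
    (hz : z ⟨0, by simp⟩ = 1) (h0 : (momentMatrix k z).PosSemidef)
    (h : ∀ j : σ, (localizingMatrix (X j) k z).PosSemidef) {p : MvPolynomial σ ℝ}
    (hp : IsCopSOSConvex p) {u : σ → ℝ} (hu : 0 ≤ u)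
    (hzu : ∀ j, rieszLinear z (X j) = u j)
    (hd : (taylorRem u p).totalDegree ≤ 2 * k) : eval u p ≤ riesz z p := by
  have := rieszLinear_nonneg_of_mem_qmodTrunc h0 h
    (mem_qmodTrunc_of_mem_qmod (taylorRem_mem_qmod hu hp) hd)
  -- The linear Taylor terms are annihilated because the first moments of `z` are `u`.
  have hlin : ∀ j, rieszLinear z ((X j - C (u j)) * C (eval u (pderiv j p))) = 0 := fun j => by
    rw [mul_comm (X j - C (u j)), ← smul_eq_C_mul, map_smul, map_sub, hzu, rieszLinear_C, hz]
    simp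
  rw [taylorRem, map_sub, map_sub, map_sum, rieszLinear_C, hz,
    Finset.sum_eq_zero fun j _ => hlin j, rieszLinear_apply] at this
  linarith

/-- The Riesz functional of the moments of a point mass is evaluation. -/
theorem rieszLinear_eq_eval {x : σ → ℝ} (hz : ∀ α : Exps σ t, z α = α.1.prod fun i e => x i ^ e)
    {p : MvPolynomial σ ℝ} (hp : p.totalDegree ≤ t) : rieszLinear z p = eval x p := by
  rw [rieszLinear_apply, riesz, eval_eq]
  refine Finset.sum_congr rfl fun α hα => ?_
  have hα' : α.degree ≤ t := (le_totalDegree hα).trans hp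
  rw [dif_pos hα', hz]
  rfl

theorem posSemidef_of_mul_mul {ι : Type*} {w : ℝ} (hw : 0 ≤ w) (v : ι → ℝ) :
    (Matrix.of fun i j => w * (v i * v j)).PosSemidef := by
  refine ⟨by ext i j; simp [mul_comm (v i)], fun x => ?_⟩
  have : 0 ≤ w * ((x.sum fun i c => c * v i) * (x.sum fun i c => c * v i)) :=
    mul_nonneg hw (mul_self_nonneg _)
  refine this.trans_eq ?_
  rw [Finsupp.sum, Finset.sum_mul_sum, Finset.mul_sum, Finsupp.sum]
  refine Finset.sum_congr rfl fun i _ => ?_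
  rw [Finset.mul_sum, Finsupp.sum]
  refine Finset.sum_congr rfl fun j _ => ?_
  rw [Matrix.of_apply, star_trivial]
  ring

theorem posSemidef_rieszLinear_of_eval {k : ℕ} {x : σ → ℝ}
    (hz : ∀ α : Exps σ t, z α = α.1.prod fun i e => x i ^ e) {w : MvPolynomial σ ℝ}
    (hw : 0 ≤ eval x w) (hd : w.totalDegree + 2 * k ≤ t) :
    (Matrix.of fun α β : Exps σ k =>
      rieszLinear z (w * (monomial α.1 1 * monomial β.1 1))).PosSemidef := by
  convert posSemidef_of_mul_mul hw (fun α : Exps σ k => eval x (monomial α.1 1)) using 4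
    with α β
  rw [rieszLinear_eq_eval z hz, map_mul, map_mul]
  have h1 : (monomial α.1 (1 : ℝ)).totalDegree ≤ k := (totalDegree_monomial_le _ _).trans α.2
  have h2 : (monomial β.1 (1 : ℝ)).totalDegree ≤ k := (totalDegree_monomial_le _ _).trans β.2
  have h3 := totalDegree_mul (monomial α.1 (1 : ℝ)) (monomial β.1 1)
  have h4 := totalDegree_mul w (monomial α.1 1 * monomial β.1 1)
  omega

theorem momentMatrix_posSemidef {k : ℕ} {z : Exps σ (2 * k) → ℝ} {x : σ → ℝ}
    (hz : ∀ α : Exps σ (2 * k), z α = α.1.prod fun i e => x i ^ e) :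
    (momentMatrix k z).PosSemidef := by
  rw [rieszLinear_momentMatrix]
  exact posSemidef_rieszLinear_of_eval z hz (by simp) (by simp)

theorem localizingMatrix_posSemidef {k : ℕ} {z : Exps σ (2 * k) → ℝ} {x : σ → ℝ} (hk : 1 ≤ k)
    (hx : 0 ≤ x) (hz : ∀ α : Exps σ (2 * k), z α = α.1.prod fun i e => x i ^ e) (j : σ) :
    (localizingMatrix (X j) k z).PosSemidef := by
  refine posSemidef_rieszLinear_of_eval z hz (by simpa using hx j) ?_
  rw [totalDegree_X]
  omega

end Riesz

/-! ### Farkas' lemma -/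

/-- **Farkas' lemma** for finitely many linear functionals. -/
theorem exists_eq_sum_of_forall_nonneg {V ι : Type*} [AddCommGroup V] [Module ℝ V]
    (s : Finset ι) (a : ι → V →ₗ[ℝ] ℝ) (c : V →ₗ[ℝ] ℝ)
    (h : ∀ x, (∀ i ∈ s, 0 ≤ a i x) → 0 ≤ c x) :
    ∃ w : ι → ℝ, 0 ≤ w ∧ c = ∑ i ∈ s, w i • a i := by
  classical
  induction s using Finset.induction_on generalizing a c with
  | empty =>
    refine ⟨0, le_rfl, ?_⟩
    ext x
    have h1 := h x (by simp)
    have h2 := h (-x) (by simp)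
    rw [map_neg] at h2
    simp only [Finset.sum_empty, LinearMap.zero_apply]
    linarith
  | insert i s hi ih =>
    by_cases hs : ∀ x, (∀ j ∈ s, 0 ≤ a j x) → 0 ≤ c x
    · obtain ⟨w, hw, hc⟩ := ih a c hs
      refine ⟨Function.update w i 0, fun j => ?_, ?_⟩
      · by_cases hj : j = i
        · subst hj; simp
        · simpa [hj] using hw j
      · rw [Finset.sum_insert hi, Function.update_self, zero_smul, zero_add, hc]
        refine Finset.sum_congr rfl fun j hj => ?_
        rw [Function.update_of_ne (by rintro rfl; exact hi hj)]
    · push Not at hs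
      obtain ⟨x₁, hx₁, hc₁⟩ := hs
      have hi₁ : a i x₁ < 0 := by
        by_contra! hneg
        exact absurd (h x₁ fun j hj => by
          rcases Finset.mem_insert.mp hj with rfl | hj
          exacts [hneg, hx₁ j hj]) (not_le.mpr hc₁)
      -- Normalized so that `a i x₀ = -1`: then `x ↦ x + a i x • x₀` projects onto the kernel of `a
      -- i`, and the induction hypothesis is applied to the functionals composed with this
      -- projection.
      set x₀ := (-(a i x₁)⁻¹) • x₁ with hx₀
      have hpos : 0 < -(a i x₁)⁻¹ := neg_pos.mpr (inv_lt_zero.mpr hi₁)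
      have h0 : a i x₀ = -1 := by
        rw [hx₀, map_smul, smul_eq_mul, neg_mul, inv_mul_cancel₀ hi₁.ne]
      have hs₀ : ∀ j ∈ s, 0 ≤ a j x₀ := fun j hj => by
        rw [hx₀, map_smul]; exact mul_nonneg hpos.le (hx₁ j hj)
      have hc₀ : c x₀ < 0 := by
        rw [hx₀, map_smul]; exact mul_neg_of_pos_of_neg hpos hc₁
      obtain ⟨w, hw, hc⟩ := ih (fun j => a j + a j x₀ • a i) (c + c x₀ • a i) fun x hx => by
        have := h (x + a i x • x₀) fun j hj => by
          rcases Finset.mem_insert.mp hj with rfl | hj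
          · rw [map_add, map_smul, h0]; simp
          · have := hx j hj
            simp only [LinearMap.add_apply, LinearMap.smul_apply, smul_eq_mul] at this
            rw [map_add, map_smul, smul_eq_mul]
            linarith
        rw [map_add, map_smul, smul_eq_mul] at this
        simp only [LinearMap.add_apply, LinearMap.smul_apply, smul_eq_mul]
        linarith
      refine ⟨Function.update w i (∑ j ∈ s, w j * a j x₀ - c x₀), fun j => ?_, ?_⟩
      · by_cases hj : j = i
        · subst hj
          have : 0 ≤ ∑ l ∈ s, w l * a l x₀ :=
            Finset.sum_nonneg fun l hl => mul_nonneg (hw l) (hs₀ l hl)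
          simp only [Function.update_self, Pi.zero_apply]
          linarith
        · simpa [hj] using hw j
      · rw [Finset.sum_insert hi, Function.update_self]
        have hsum : ∑ j ∈ s, Function.update w i (∑ j ∈ s, w j * a j x₀ - c x₀) j • a j =
            ∑ j ∈ s, w j • a j := Finset.sum_congr rfl fun j hj => by
          rw [Function.update_of_ne (by rintro rfl; exact hi hj)]
        rw [hsum]
        ext x
        have := LinearMap.congr_fun hc x
        simp only [LinearMap.add_apply, LinearMap.smul_apply, smul_eq_mul,
          LinearMap.sum_apply, mul_add, Finset.sum_add_distrib, ← mul_assoc,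
          ← Finset.sum_mul] at this ⊢
        linarith

/-! ### Attainment of the infimum of a convex polynomial on a polyhedron -/

section FrankWolfe

variable {σ : Type*} [Fintype σ]

/-- A univariate polynomial bounded on a half-line is constant, hence constant also for negative
`t`. -/
theorem eval_add_smul_eq_of_bounded {σ : Type*} {p : MvPolynomial σ ℝ} {y v : σ → ℝ} {m M : ℝ}
    (h : ∀ t : ℝ, 0 ≤ t → m ≤ eval (y + t • v) p ∧ eval (y + t • v) p ≤ M) (t : ℝ) :
    eval (y + t • v) p = eval y p := by
  set q : Polynomial ℝ := segmentPoly y v p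
  have hq : ∀ t, q.eval t = eval (y + t • v) p := fun t => by
    rw [eval_segmentPoly, ← coe_aeval_eq_eval]; rfl
  have hdeg : q.degree ≤ 0 := by
    rw [← Polynomial.isBoundedUnder_abs_atTop_iff]
    refine ⟨max |m| |M|, ?_⟩
    rw [eventually_map]
    filter_upwards [eventually_ge_atTop 0] with t ht
    rw [hq]
    exact abs_le_max_abs_abs (h t ht).1 (h t ht).2
  rw [Polynomial.eq_C_of_degree_le_zero hdeg] at hq
  have h0 := hq 0
  rw [← hq t]
  rw [zero_smul, add_zero] at h0
  rw [← h0, Polynomial.eval_C, Polynomial.eval_C]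

/-- A polynomial that is convex and bounded below on a polyhedron attains its infimum there. -/
theorem exists_isMinOn_of_convexOn_polyhedron {ι : Type*} [Finite ι]
    (a : ι → (σ → ℝ) →L[ℝ] ℝ) (β : ι → ℝ) {K : Set (σ → ℝ)}
    (hK : K = {x | ∀ i, β i ≤ a i x}) (p : MvPolynomial σ ℝ)
    (hconv : ConvexOn ℝ K fun x => eval x p) (hne : K.Nonempty) {m₀ : ℝ}
    (hm₀ : ∀ x ∈ K, m₀ ≤ eval x p) : ∃ x ∈ K, IsMinOn (fun x => eval x p) K x := by
  by_contra! hno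
  set f : (σ → ℝ) → ℝ := fun x => eval x p with hf
  have hfc : Continuous f := MvPolynomial.continuous_eval p
  have hKc : IsClosed K := by
    rw [hK, Set.ofPred_forall]
    exact isClosed_iInter fun i => isClosed_le continuous_const (a i).continuous
  have hbdd : BddBelow (f '' K) := ⟨m₀, by rintro _ ⟨x, hx, rfl⟩; exact hm₀ x hx⟩
  set m := sInf (f '' K)
  have hm : ∀ x ∈ K, m ≤ f x := fun x hx => csInf_le hbdd ⟨x, hx, rfl⟩
  have hlt : ∀ x ∈ K, m < f x := fun x hx => lt_of_le_of_ne (hm x hx) fun h =>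
    hno x hx fun y hy => by
      change f x ≤ f y
      rw [← h]; exact hm y hy
  -- A minimizing sequence whose terms have least norm in their own sublevel sets.
  have hex : ∀ n : ℕ, ∃ x ∈ K, f x ≤ m + 1 / (n + 1) ∧
      ∀ y ∈ K, f y ≤ f x → ‖x‖ ≤ ‖y‖ := by
    intro n
    set S := K ∩ {x | f x ≤ m + 1 / ((n : ℝ) + 1)}
    have hS : IsClosed S := hKc.inter (isClosed_le hfc continuous_const)
    have hSne : S.Nonempty := by
      have hpos : (0 : ℝ) < 1 / ((n : ℝ) + 1) := by positivity
      obtain ⟨_, ⟨x, hx, rfl⟩, hlt⟩ := exists_lt_of_csInf_lt (hne.image f)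
        (lt_add_of_pos_right m hpos)
      exact ⟨x, hx, hlt.le⟩
    obtain ⟨x, hx, hd⟩ := hS.exists_infDist_eq_dist hSne 0
    refine ⟨x, hx.1, hx.2, fun y hy hyx => ?_⟩
    have := Metric.infDist_le_dist_of_mem (x := 0) (show y ∈ S from ⟨hy, hyx.trans hx.2⟩)
    rwa [hd, dist_zero_left, dist_zero_left] at this
  choose x hxK hxf hxmin using hex
  have hfx1 : ∀ n, f (x n) ≤ m + 1 := fun n => (hxf n).trans (by
    have : 1 / ((n : ℝ) + 1) ≤ 1 := by
      rw [div_le_one (by positivity)]; linarith [n.cast_nonneg (α := ℝ)]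
    linarith)
  -- On a bounded part of `K` the minimum is attained and exceeds `m`, so the sequence leaves it.
  have hnorm : Tendsto (fun n => ‖x n‖) atTop atTop := by
    rw [tendsto_atTop]
    intro R
    by_cases hR : (K ∩ Metric.closedBall 0 R).Nonempty
    · obtain ⟨y, hy, hymin⟩ := ((isCompact_closedBall (0 : σ → ℝ) R).inter_left hKc).exists_isMinOn
        hR hfc.continuousOn
      have hev : ∀ᶠ n : ℕ in atTop, m + 1 / ((n : ℝ) + 1) < f y := by
        have := (tendsto_one_div_add_atTop_nhds_zero_nat (𝕜 := ℝ)).const_add m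
        rw [add_zero] at this
        exact this.eventually (gt_mem_nhds (hlt y hy.1))
      filter_upwards [hev] with n hn
      by_contra! hlt'
      have := hymin (show x n ∈ K ∩ Metric.closedBall 0 R from
        ⟨hxK n, by simpa using hlt'.le⟩)
      have h2 : f y ≤ f (x n) := this
      linarith [hxf n]
    · filter_upwards with n
      by_contra! hlt'
      exact hR ⟨x n, hxK n, by simpa using hlt'.le⟩
  obtain ⟨v, -, φ, hφ, hv⟩ := (isCompact_closedBall (0 : σ → ℝ) 1).tendsto_subseq
    (x := fun n => ‖x n‖⁻¹ • x n) (fun n => by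
      rw [mem_closedBall_zero_iff, norm_smul, norm_inv, norm_norm]
      exact inv_mul_le_one)
  have hnormφ := hnorm.comp hφ.tendsto_atTop
  -- The limit direction `v` is a recession direction of `K` along which `f` does not increase:
  -- convex combinations of `y` and `x (φ n)` with weight `t / ‖x (φ n)‖` tend to `y + t v`.
  have hrec : ∀ y ∈ K, ∀ t : ℝ, 0 ≤ t → y + t • v ∈ K ∧ f (y + t • v) ≤ f y := by
    intro y hy t ht
    have hlam : Tendsto (fun n => t / ‖x (φ n)‖) atTop (𝓝 0) := hnormφ.const_div_atTop t
    have hz : Tendsto (fun n => (1 - t / ‖x (φ n)‖) • y + (t / ‖x (φ n)‖) • x (φ n)) atTop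
        (𝓝 (y + t • v)) := by
      have h1 : Tendsto (fun n => (1 - t / ‖x (φ n)‖) • y) atTop (𝓝 y) := by
        simpa using (hlam.const_sub 1).smul_const y
      have h2 := hv.const_smul t
      refine h1.add (h2.congr fun n => ?_)
      simp only [Function.comp_apply, smul_smul, div_eq_mul_inv]
    have hlam1 : ∀ᶠ n in atTop, t / ‖x (φ n)‖ ≤ 1 := hlam.eventually (ge_mem_nhds one_pos)
    refine ⟨hKc.mem_of_tendsto hz ?_, ?_⟩
    · filter_upwards [hlam1] with n hn
      exact hconv.1 hy (hxK _) (by linarith) (div_nonneg ht (norm_nonneg _)) (by ring)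
    · have hub : Tendsto (fun n => (1 - t / ‖x (φ n)‖) * f y + t / ‖x (φ n)‖ * (m + 1)) atTop
          (𝓝 (f y)) := by
        have := ((hlam.const_sub 1).mul_const (f y)).add (hlam.mul_const (m + 1))
        simpa using this
      refine le_of_tendsto_of_tendsto ((hfc.tendsto _).comp hz) hub ?_
      filter_upwards [hlam1] with n hn
      have hl0 : 0 ≤ t / ‖x (φ n)‖ := div_nonneg ht (norm_nonneg _)
      refine (hconv.2 hy (hxK (φ n)) (by linarith) hl0 (by ring)).trans ?_
      rw [smul_eq_mul, smul_eq_mul]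
      gcongr
      exact hfx1 _
  have hconst : ∀ y ∈ K, ∀ t : ℝ, f (y + t • v) = f y := fun y hy t =>
    eval_add_smul_eq_of_bounded (fun t ht =>
      ⟨hm _ (hrec y hy t ht).1, (hrec y hy t ht).2⟩) t
  -- Polyhedrality enters here: subtracting `v` is harmless if `a i v ≤ 0`, and otherwise `a i (x (φ
  -- n))` tends to infinity.
  have hmem : ∀ᶠ n in atTop, x (φ n) + (-1 : ℝ) • v ∈ K := by
    simp only [hK, Set.mem_ofPred_eq]
    rw [eventually_all]
    intro i
    have hxi : ∀ n, β i ≤ a i (x n) := fun n => by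
      have := hxK n; rw [hK] at this; exact this i
    rcases le_or_gt (a i v) 0 with hi | hi
    · filter_upwards with n
      rw [map_add, map_smul, smul_eq_mul]
      linarith [hxi (φ n)]
    · have h1 : Tendsto (fun n => a i (‖x (φ n)‖⁻¹ • x (φ n))) atTop (𝓝 (a i v)) :=
        ((a i).continuous.tendsto _).comp hv
      have h2 := hnormφ.atTop_mul_pos hi h1
      filter_upwards [h2.eventually_ge_atTop (β i + a i v), hnormφ.eventually_gt_atTop 0]
        with n hn hpos
      simp only [Function.comp_apply, map_smul, smul_eq_mul] at hn hpos
      rw [mul_inv_cancel_left₀ hpos.ne'] at hn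
      rw [map_add, map_smul, smul_eq_mul]
      linarith
  have hclose : ∀ᶠ n in atTop, ‖‖x (φ n)‖⁻¹ • x (φ n) - v‖ < 1 := by
    have := (tendsto_iff_norm_sub_tendsto_zero.mp hv).eventually (gt_mem_nhds one_pos)
    exact this
  -- Now `x (φ n) - v` has the same value but smaller norm, contradicting the choice of `x`.
  obtain ⟨n, hn1, hn2, hn3⟩ :=
    (hmem.and (hclose.and (hnormφ.eventually_ge_atTop 1))).exists
  have hmin := hxmin (φ n) _ hn1 (hconst _ (hxK _) _).le
  simp only [Function.comp_apply] at hn3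
  have hpos : ‖x (φ n)‖ ≠ 0 := by linarith
  have heq : x (φ n) + (-1 : ℝ) • v = (‖x (φ n)‖ - 1) • (‖x (φ n)‖⁻¹ • x (φ n)) +
      (‖x (φ n)‖⁻¹ • x (φ n) - v) := by
    rw [sub_smul, smul_inv_smul₀ hpos, one_smul, neg_smul, one_smul]
    abel
  have hle := norm_add_le ((‖x (φ n)‖ - 1) • (‖x (φ n)‖⁻¹ • x (φ n)))
    (‖x (φ n)‖⁻¹ • x (φ n) - v)
  rw [← heq, norm_smul, norm_smul, norm_inv, norm_norm, inv_mul_cancel₀ hpos, mul_one,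
    Real.norm_of_nonneg (by linarith)] at hle
  linarith

end FrankWolfe

/-! ### Degrees under renaming, and affine polynomials -/

theorem degree_embDomain {σ τ : Type*} (e : σ ↪ τ) (α : σ →₀ ℕ) :
    (α.embDomain e).degree = α.degree := by
  simp only [Finsupp.degree_apply]
  exact Finsupp.sum_embDomain (f := e) (v := α) (g := fun _ e => e)

theorem totalDegree_le_totalDegree_rename {σ τ : Type*} (e : σ ↪ τ) (p : MvPolynomial σ ℝ) :
    p.totalDegree ≤ (rename e p).totalDegree := by
  refine Finset.sup_le fun α hα => ?_
  have hmem : α.embDomain e ∈ (rename e p).support := by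
    rw [mem_support_iff, coeff_rename_embDomain]
    exact mem_support_iff.mp hα
  have h := le_totalDegree hmem
  rwa [Finsupp.sum_embDomain] at h

theorem exists_affine_of_totalDegree_le_one {σ : Type*} [Fintype σ] {p : MvPolynomial σ ℝ}
    (hp : p.totalDegree ≤ 1) :
    ∃ (e : ℝ) (c : σ → ℝ), p = C e + ∑ j, C (c j) * X j := by
  classical
  rw [p.as_sum]
  refine Finset.sum_induction _
    (fun q : MvPolynomial σ ℝ => ∃ (e : ℝ) (c : σ → ℝ), q = C e + ∑ j, C (c j) * X j) ?_ ?_ ?_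
  · rintro _ _ ⟨e, c, rfl⟩ ⟨e', c', rfl⟩
    refine ⟨e + e', c + c', ?_⟩
    simp only [C_add, Pi.add_apply, add_mul, Finset.sum_add_distrib]
    ring
  · exact ⟨0, 0, by simp⟩
  · intro α hα
    by_cases h0 : α = 0
    · exact ⟨coeff α p, 0, by simp [h0]⟩
    · obtain ⟨j, hj⟩ := Finsupp.support_nonempty_iff.mpr h0
      have hd : α.degree ≤ 1 := (le_totalDegree hα).trans hp
      have hα1 : α = Finsupp.single j 1 := by
        have hle : Finsupp.single j 1 ≤ α := by
          rw [Finsupp.single_le_iff]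
          exact Nat.one_le_iff_ne_zero.mpr (Finsupp.mem_support_iff.mp hj)
        obtain ⟨δ, rfl⟩ := exists_add_of_le hle
        rw [map_add, Finsupp.degree_single] at hd
        rw [(Finsupp.degree_eq_zero_iff δ).mp (by omega), add_zero]
      refine ⟨0, Pi.single j (coeff α p), ?_⟩
      rw [Finset.sum_eq_single j (fun i _ hi => by simp [hi]) (by simp), C_0, zero_add,
        Pi.single_eq_same, C_mul_X_eq_monomial, ← hα1]

/-- An affine polynomial that is nonnegative on the orthant and nonpositive at an interior point
of the orthant is constant. -/
theorem OrthantNonneg.totalDegree_eq_zero {σ : Type*} [Fintype σ]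
    {q : MvPolynomial σ ℝ} (hq : OrthantNonneg q) (hd : q.totalDegree ≤ 1) {x : σ → ℝ}
    (hx : ∀ j, 0 < x j) (hqx : eval x q ≤ 0) : q.totalDegree = 0 := by
  classical
  obtain ⟨e, c, rfl⟩ := exists_affine_of_totalDegree_le_one hd
  have heval : ∀ y, eval y (C e + ∑ j, C (c j) * X j : MvPolynomial σ ℝ) = e + c ⬝ᵥ y :=
    fun y => by simp [dotProduct]
  have hc : c = 0 := by
    funext j
    -- Both `x ± x_j e_j` lie in the orthant, and the value of `q` changes there by `± c_j x_j`.
    have h1 := hq (x - Pi.single j (x j)) fun i => by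
      by_cases h : i = j
      · subst h; simp
      · simpa [h] using (hx i).le
    have h2 := hq (x + Pi.single j (x j)) fun i => by
      by_cases h : i = j
      · subst h; simpa using (hx i).le
      · simpa [h] using (hx i).le
    rw [heval] at h1 h2 hqx
    rw [dotProduct_sub, dotProduct_single] at h1
    rw [dotProduct_add, dotProduct_single] at h2
    exact (mul_eq_zero.mp (show c j * x j = 0 by linarith)).resolve_right (hx j).ne'
  simp [hc]

/-- The first-order Taylor polynomial of `p` at `u`. -/
noncomputable def taylorAffine {σ : Type*} [Fintype σ] (u : σ → ℝ) (p : MvPolynomial σ ℝ) :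
    MvPolynomial σ ℝ :=
  C (eval u p) + ∑ j, (X j - C (u j)) * C (eval u (pderiv j p))

theorem taylorRem_add_taylorAffine {σ : Type*} [Fintype σ] (u : σ → ℝ) (p : MvPolynomial σ ℝ) :
    taylorRem u p + taylorAffine u p = p := by
  rw [taylorRem, taylorAffine]; ring

theorem totalDegree_taylorAffine_le {σ : Type*} [Fintype σ] (u : σ → ℝ)
    (p : MvPolynomial σ ℝ) : (taylorAffine u p).totalDegree ≤ 1 := by
  refine (totalDegree_add _ _).trans (max_le (by simp) (totalDegree_finsetSum_le fun j _ => ?_))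
  refine (totalDegree_mul _ _).trans ?_
  rw [totalDegree_C, add_zero]
  refine (totalDegree_sub _ _).trans ?_
  simp [totalDegree_X]

theorem eval_taylorRem_self {σ : Type*} [Fintype σ] (u : σ → ℝ) (p : MvPolynomial σ ℝ) :
    eval u (taylorRem u p) = 0 := by
  simp [taylorRem]

/-- The Taylor remainder vanishes to second order along segments. -/
theorem exists_eval_taylorRem_eq {σ : Type*} [Fintype σ] (u v : σ → ℝ)
    (p : MvPolynomial σ ℝ) : ∃ B : ℝ → ℝ, Continuous B ∧
      ∀ t, eval (u + t • v) (taylorRem u p) = t * (t * B t) := by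
  obtain ⟨h, hh⟩ := exists_taylorRem_eq_sum u p
  refine ⟨fun t => ∑ i, ∑ j, v i * v j * eval (u + t • v) (h i j), ?_, fun t => ?_⟩
  · refine continuous_finsetSum _ fun i _ => continuous_finsetSum _ fun j _ =>
      continuous_const.mul ((MvPolynomial.continuous_eval _).comp (by fun_prop))
  · rw [hh]
    simp only [map_sum, map_mul, map_sub, eval_X, eval_C, Pi.add_apply, Pi.smul_apply,
      smul_eq_mul, add_sub_cancel_left, Finset.mul_sum]
    exact Finset.sum_congr rfl fun i _ => Finset.sum_congr rfl fun j _ => by ring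

namespace Problem

variable {n m m₁ m₂ : ℕ} (P : Problem n m m₁ m₂)

/-! ### The sparse quadratic module -/

theorem lift_add (i : Fin m) (p q : MvPolynomial (P.Δ i) ℝ) :
    P.lift i (p + q) = P.lift i p + P.lift i q := map_add _ _ _

theorem eval_lift (i : Fin m) (p : MvPolynomial (P.Δ i) ℝ) (x : Fin n → ℝ) :
    eval x (P.lift i p) = eval (fun j => x j.1) p := eval_rename _ _ _

theorem totalDegree_lift (i : Fin m) (p : MvPolynomial (P.Δ i) ℝ) :
    (P.lift i p).totalDegree = p.totalDegree :=
  le_antisymm (totalDegree_rename_le _ _)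
    (totalDegree_le_totalDegree_rename (Function.Embedding.subtype _) p)

theorem orthantNonneg_lift {i : Fin m} {p : MvPolynomial (P.Δ i) ℝ} (hp : OrthantNonneg p) :
    OrthantNonneg (P.lift i p) := fun x hx => by
  rw [eval_lift]; exact hp _ fun j => hx j.1

/-- The sparse quadratic module of the orthant, without degree bounds. -/
noncomputable def sparseModule : AddSubmonoid (MvPolynomial (Fin n) ℝ) where
  carrier := {q | ∃ p : ∀ i : Fin m, MvPolynomial (P.Δ i) ℝ,
    (∀ i, p i ∈ qmod (P.Δ i)) ∧ q = ∑ i, P.lift i (p i)}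
  zero_mem' := ⟨0, fun _ => zero_mem_qmod, by simp [lift]⟩
  add_mem' := by
    rintro _ _ ⟨p, hp, rfl⟩ ⟨q, hq, rfl⟩
    exact ⟨p + q, fun i => add_mem_qmod (hp i) (hq i), by
      simp only [Pi.add_apply, lift_add, Finset.sum_add_distrib]⟩

theorem lift_mem_sparseModule {i : Fin m} {q : MvPolynomial (P.Δ i) ℝ} (hq : q ∈ qmod (P.Δ i)) :
    P.lift i q ∈ P.sparseModule := by
  classical
  refine ⟨Pi.single i q, fun j => ?_, ?_⟩
  · by_cases h : j = i
    · subst h; simpa using hq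
    · rw [Pi.single_eq_of_ne h]; exact zero_mem_qmod
  · rw [Finset.sum_eq_single i (fun j _ hj => by simp [hj, lift]) (by simp), Pi.single_eq_same]

/-- Covering places each variable in some block; this absorbs the multipliers of `x ≥ 0`. -/
theorem C_mul_X_mem_sparseModule {c : ℝ} (hc : 0 ≤ c) (j : Fin n) :
    MvPolynomial.C c * X j ∈ P.sparseModule := by
  classical
  obtain ⟨i, hi⟩ := P.cover j
  have : MvPolynomial.C c * X j = P.lift i (MvPolynomial.C c * X ⟨j, hi⟩) := by simp [lift]
  rw [this]
  refine P.lift_mem_sparseModule ⟨0, Pi.single ⟨j, hi⟩ (MvPolynomial.C c), .zero, fun l => ?_, ?_⟩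
  · by_cases h : l = ⟨j, hi⟩
    · subst h; simpa using isSumSq_C hc
    · simp [h, IsSumSq.zero]
  · rw [Finset.sum_eq_single ⟨j, hi⟩ (fun l _ hl => by simp [hl]) (by simp), Pi.single_eq_same,
      zero_add, mul_comm]

theorem orthantNonneg_of_mem_sparseModule {q : MvPolynomial (Fin n) ℝ}
    (hq : q ∈ P.sparseModule) : OrthantNonneg q := by
  obtain ⟨p, hp, rfl⟩ := hq
  exact .sum fun i _ => P.orthantNonneg_lift (orthantNonneg_of_mem_qmod (hp i))

theorem mem_sparseModule_of_mem_sparseQmod {k : ℕ} {q : MvPolynomial (Fin n) ℝ}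
    (hq : q ∈ P.sparseQmod k) : q ∈ P.sparseModule := by
  obtain ⟨p, hp, rfl⟩ := hq
  exact ⟨p, fun i => mem_qmod_of_mem_qmodTrunc (hp i), rfl⟩

/-- There is no cancellation across blocks either. -/
theorem mem_sparseQmod_of_mem_sparseModule {k : ℕ} {q : MvPolynomial (Fin n) ℝ}
    (hq : q ∈ P.sparseModule) (hk : q.totalDegree ≤ 2 * k) : q ∈ P.sparseQmod k := by
  obtain ⟨p, hp, rfl⟩ := hq
  refine ⟨p, fun i => mem_qmodTrunc_of_mem_qmod (hp i) ?_, rfl⟩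
  rw [← P.totalDegree_lift]
  exact (OrthantNonneg.totalDegree_le_sum (p := fun i => P.lift i (p i))
    (fun i _ => P.orthantNonneg_lift (orthantNonneg_of_mem_qmod (hp i)))
    (Finset.mem_univ i)).trans hk

/-! ### Taylor expansion of the objective -/

theorem exists_objective_eq (u : Fin n → ℝ) : ∃ (e : ℝ) (c : Fin n → ℝ),
    P.objective = ∑ i, P.lift i (taylorRem (fun j => u j.1) (P.f i)) +
      (MvPolynomial.C e + ∑ j, MvPolynomial.C (c j) * X j) := by
  obtain ⟨e, c, h⟩ := exists_affine_of_totalDegree_le_one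
    (p := ∑ i, P.lift i (taylorAffine (fun j => u j.1) (P.f i)))
    (totalDegree_finsetSum_le fun i _ => by
      rw [totalDegree_lift]; exact totalDegree_taylorAffine_le _ _)
  refine ⟨e, c, ?_⟩
  rw [← h, ← Finset.sum_add_distrib, objective]
  exact Finset.sum_congr rfl fun i _ => by rw [← lift_add, taylorRem_add_taylorAffine]

theorem totalDegree_affine_le {σ : Type*} [Fintype σ] (e : ℝ) (c : σ → ℝ) :
    (MvPolynomial.C e + ∑ j, MvPolynomial.C (c j) * X j : MvPolynomial σ ℝ).totalDegree ≤ 1 := by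
  refine (totalDegree_add _ _).trans (max_le (by simp) (totalDegree_finsetSum_le fun j _ => ?_))
  refine (totalDegree_mul _ _).trans ?_
  simp [totalDegree_X]

variable {P}

theorem taylorRem_block_mem_qmod (hconv : ∀ i, IsCopSOSConvex (P.f i)) {u : Fin n → ℝ}
    (hu : 0 ≤ u) (i : Fin m) : taylorRem (fun j : P.Δ i => u j.1) (P.f i) ∈ qmod (P.Δ i) := by
  have hu' : 0 ≤ fun j : P.Δ i => u j.1 := fun j => hu j.1
  exact taylorRem_mem_qmod hu' (hconv i)

/-- The `f_i` might cancel in `f`, but their remainders cannot: they sum to `f` minus an affine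
polynomial, of degree at most `2k` since `k ≥ 1`. -/
theorem totalDegree_taylorRem_le (hconv : ∀ i, IsCopSOSConvex (P.f i)) {k : ℕ}
    (hk : P.k₀ ≤ k) (hk1 : 1 ≤ k) {u : Fin n → ℝ} (hu : 0 ≤ u) (i : Fin m) :
    (taylorRem (fun j : P.Δ i => u j.1) (P.f i)).totalDegree ≤ 2 * k := by
  obtain ⟨e, c, h⟩ := P.exists_objective_eq u
  rw [← P.totalDegree_lift]
  refine (OrthantNonneg.totalDegree_le_sum
    (p := fun i => P.lift i (taylorRem (fun j => u j.1) (P.f i)))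
    (fun i _ => P.orthantNonneg_lift (orthantNonneg_of_mem_qmod
      (taylorRem_block_mem_qmod hconv hu i))) (Finset.mem_univ i)).trans ?_
  rw [← sub_eq_iff_eq_add] at h
  rw [← h]
  refine (totalDegree_sub _ _).trans (max_le ?_ ((totalDegree_affine_le e c).trans (by omega)))
  rw [k₀] at hk
  omega

/-- Ensures that `riesz` drops no monomial of `f_i`. -/
theorem totalDegree_f_le (hconv : ∀ i, IsCopSOSConvex (P.f i)) {k : ℕ}
    (hk : P.k₀ ≤ k) (hk1 : 1 ≤ k) (i : Fin m) : (P.f i).totalDegree ≤ 2 * k := by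
  rw [← taylorRem_add_taylorAffine (fun j : P.Δ i => (0 : Fin n → ℝ) j.1) (P.f i)]
  exact (totalDegree_add _ _).trans (max_le (totalDegree_taylorRem_le hconv hk hk1 le_rfl i)
    ((totalDegree_taylorAffine_le _ _).trans (by omega)))

/-- The Taylor expansion of the objective at a point of the orthant. -/
theorem exists_supporting (hconv : ∀ i, IsCopSOSConvex (P.f i)) {u : Fin n → ℝ} (hu : 0 ≤ u) :
    ∃ (c : Fin n → ℝ) (R : MvPolynomial (Fin n) ℝ), R ∈ P.sparseModule ∧
      (∀ x, eval x P.objective = eval x R + eval u P.objective + c ⬝ᵥ (x - u)) ∧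
      ∀ v, ∃ B : ℝ → ℝ, Continuous B ∧ ∀ t, eval (u + t • v) R = t * (t * B t) := by
  obtain ⟨e, c, h⟩ := P.exists_objective_eq u
  refine ⟨c, ∑ i, P.lift i (taylorRem (fun j => u j.1) (P.f i)), sum_mem fun i _ => P.lift_mem_sparseModule
      (taylorRem_block_mem_qmod hconv hu i), fun x => ?_, fun v => ?_⟩
  · have h0 : eval u (∑ i, P.lift i (taylorRem (fun j => u j.1) (P.f i))) = 0 := by
      rw [map_sum]
      exact Finset.sum_eq_zero fun i _ => by rw [eval_lift, eval_taylorRem_self]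
    have hx := congrArg (eval x) h
    have hu := congrArg (eval u) h
    rw [map_add, h0] at hu
    rw [map_add] at hx
    rw [hx, hu]
    simp only [map_add, map_sum, map_mul, eval_C, eval_X, dotProduct, Pi.sub_apply, mul_sub,
      Finset.sum_sub_distrib]
    ring
  · choose B hB hBt using fun i : Fin m =>
      exists_eval_taylorRem_eq (fun j : P.Δ i => u j.1) (fun j => v j.1) (P.f i)
    refine ⟨fun t => ∑ i, B i t, continuous_finsetSum _ fun i _ => hB i, fun t => ?_⟩
    rw [map_sum, Finset.mul_sum, Finset.mul_sum]
    exact Finset.sum_congr rfl fun i _ => by rw [eval_lift, ← hBt]; rfl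

/-! ### The moment relaxation -/

theorem eval_proj_le_momentObjective (hconv : ∀ i, IsCopSOSConvex (P.f i)) {k : ℕ}
    (hk : P.k₀ ≤ k) (hk1 : 1 ≤ k) {y : P.labels k → ℝ} (hy : y ∈ P.momentFeasibleSet k) :
    P.proj y ∈ P.feasibleSet ∧ eval (P.proj y) P.objective ≤ P.momentObjective y := by
  obtain ⟨hA, hC, hM, hL, hy0⟩ := hy
  have hz0 : ∀ i, P.sub y i ⟨0, by simp⟩ = 1 := fun i => by
    rw [← hy0, sub]; simp
  have hzX : ∀ i, ∀ j : P.Δ i, rieszLinear (P.sub y i) (X j) = P.proj y j.1 := fun i j => by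
    rw [rieszLinear_X _ (by omega), sub, proj]; simp
  -- `y_{e_j}` is the value of the functional at `x_j · 1²`.
  have hnn : 0 ≤ P.proj y := fun j => by
    obtain ⟨i, hi⟩ := P.cover j
    have h := rieszLinear_sumSq_nonneg (P.sub y i)
      (rieszLinear_localizingMatrix_posSemidef (hL i ⟨j, hi⟩)) (IsSumSq.mul_self 1) (by simp)
    rw [mul_one, mul_one, hzX] at h
    exact h
  refine ⟨⟨hA, hC, hnn⟩, ?_⟩
  rw [objective, map_sum, momentObjective]
  refine Finset.sum_le_sum fun i _ => ?_
  rw [eval_lift]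
  exact eval_le_riesz (hz0 i) (hM i) (hL i) (hconv i) (fun j => hnn j.1) (hzX i)
    (totalDegree_taylorRem_le hconv hk hk1 hnn i)

/-- The moments of the point mass at `x`. -/
noncomputable def diracMoments (P : Problem n m m₁ m₂) (k : ℕ) (x : Fin n → ℝ) :
    P.labels k → ℝ := fun α => α.1.prod fun j e => x j ^ e

theorem entry_diracMoments {k : ℕ} (x : Fin n → ℝ) {α : Fin n →₀ ℕ} {i : Fin m}
    (hs : α.support ⊆ P.Δ i) (hd : α.degree ≤ 2 * k) :
    P.entry (P.diracMoments k x) α = α.prod fun j e => x j ^ e := by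
  have : α ∈ P.labels k := ⟨i, hs, hd⟩
  rw [entry, dif_pos this, diracMoments]

theorem sub_diracMoments {k : ℕ} (x : Fin n → ℝ) (i : Fin m) (α : Exps (P.Δ i) (2 * k)) :
    P.sub (P.diracMoments k x) i α = α.1.prod fun j e => x j.1 ^ e := by
  rw [sub, entry_diracMoments (i := i)]
  · rw [Finsupp.prod_embDomain]; rfl
  · rw [Finsupp.support_embDomain]
    intro j hj
    obtain ⟨l, -, rfl⟩ := Finset.mem_map.mp hj
    exact l.2
  · rw [degree_embDomain]; exact α.2

theorem diracMoments_mem (hm : 0 < m) (hconv : ∀ i, IsCopSOSConvex (P.f i)) {k : ℕ}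
    (hk : P.k₀ ≤ k) (hk1 : 1 ≤ k) {x : Fin n → ℝ} (hx : x ∈ P.feasibleSet) :
    P.diracMoments k x ∈ P.momentFeasibleSet k ∧
      P.momentObjective (P.diracMoments k x) = eval x P.objective := by
  obtain ⟨hA, hC, hx0⟩ := hx
  have hproj : P.proj (P.diracMoments k x) = x := by
    funext j
    obtain ⟨i, hi⟩ := P.cover j
    rw [proj, entry_diracMoments (i := i)]
    · simp
    · refine Finsupp.support_single_subset.trans ?_
      simpa using hi
    · rw [Finsupp.degree_single]; omega
  refine ⟨⟨by rw [hproj, hA], by rw [hproj]; exact hC,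
    fun i => momentMatrix_posSemidef (sub_diracMoments x i),
    fun i j => localizingMatrix_posSemidef hk1 (fun l => hx0 l.1) (sub_diracMoments x i) j, ?_⟩, ?_⟩
  -- The label `0` belongs to `𝕌_k` only because some block exists.
  · rw [entry_diracMoments (i := ⟨0, hm⟩)] <;> simp
  · rw [momentObjective, objective, map_sum]
    refine Finset.sum_congr rfl fun i _ => ?_
    rw [eval_lift, ← rieszLinear_apply,
      rieszLinear_eq_eval _ (sub_diracMoments x i) (totalDegree_f_le hconv hk hk1 i)]

theorem fsmo_eq_fmin (hm : 0 < m) (hconv : ∀ i, IsCopSOSConvex (P.f i)) {k : ℕ}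
    (hk : P.k₀ ≤ k) (hk1 : 1 ≤ k) : P.fsmo k = P.fmin := by
  refine le_antisymm (le_iInf₂ fun x hx => ?_) (le_iInf₂ fun y hy => ?_)
  · obtain ⟨h1, h2⟩ := diracMoments_mem hm hconv hk hk1 hx
    rw [← h2]
    exact iInf₂_le _ h1
  · obtain ⟨h1, h2⟩ := eval_proj_le_momentObjective hconv hk hk1 hy
    exact (iInf₂_le _ h1).trans (EReal.coe_le_coe_iff.mpr h2)

theorem isMinimizer_proj (hm : 0 < m) (hconv : ∀ i, IsCopSOSConvex (P.f i)) {k : ℕ}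
    (hk : P.k₀ ≤ k) (hk1 : 1 ≤ k) {y : P.labels k → ℝ} (hy : P.IsMomentOptimizer k y) :
    P.IsMinimizer (P.proj y) := by
  obtain ⟨h1, h2⟩ := eval_proj_le_momentObjective hconv hk hk1 hy.1
  refine ⟨h1, fun x hx => h2.trans ?_⟩
  obtain ⟨h3, h4⟩ := diracMoments_mem hm hconv hk hk1 hx
  exact (hy.2 h3).trans_eq h4

/-! ### Attainment and Lagrange multipliers -/

theorem eval_g (lam : Fin m₁ → ℝ) (mu : Fin m₂ → ℝ) (x : Fin n → ℝ) :
    eval x (P.g lam mu) =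
      lam ⬝ᵥ (P.A.mulVec x - P.b) + mu ⬝ᵥ (P.C.mulVec x - P.d) := by
  simp [g, dotProduct, Matrix.mulVec]

theorem totalDegree_g_le (lam : Fin m₁ → ℝ) (mu : Fin m₂ → ℝ) :
    (P.g lam mu).totalDegree ≤ 1 := by
  have hrow : ∀ (l c : ℝ) (a : Fin n → ℝ), (MvPolynomial.C l *
      (∑ j, MvPolynomial.C (a j) * X j - MvPolynomial.C c) :
        MvPolynomial (Fin n) ℝ).totalDegree ≤ 1 := fun l c a => by
    refine (totalDegree_mul _ _).trans ?_
    rw [totalDegree_C, zero_add, sub_eq_add_neg, ← C_neg, add_comm]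
    exact totalDegree_affine_le _ _
  exact (totalDegree_add _ _).trans
    (max_le (totalDegree_finsetSum_le fun r _ => hrow _ _ _)
      (totalDegree_finsetSum_le fun r _ => hrow _ _ _))

/-- The Taylor polynomial at the convex combination is a supporting affine function on the orthant;
averaging it over the two endpoints gives convexity. -/
theorem convexOn_objective (hconv : ∀ i, IsCopSOSConvex (P.f i)) {K : Set (Fin n → ℝ)}
    (hK : Convex ℝ K) (hK0 : ∀ x ∈ K, 0 ≤ x) :
    ConvexOn ℝ K fun x => eval x P.objective := by
  refine ⟨hK, fun x hx y hy s t hs ht hst => ?_⟩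
  have hz := hK0 _ (hK hx hy hs ht hst)
  obtain ⟨c, R, hR, hexp, -⟩ := exists_supporting hconv hz
  have hRn := P.orthantNonneg_of_mem_sparseModule hR
  have hcomb : s * (c ⬝ᵥ (x - (s • x + t • y))) + t * (c ⬝ᵥ (y - (s • x + t • y))) = 0 := by
    rw [← smul_eq_mul, ← smul_eq_mul, ← dotProduct_smul, ← dotProduct_smul, ← dotProduct_add]
    have : s • (x - (s • x + t • y)) + t • (y - (s • x + t • y)) = 0 := by
      obtain rfl : s = 1 - t := by linarith
      ext j
      simp only [Pi.add_apply, Pi.smul_apply, Pi.sub_apply, smul_eq_mul, Pi.zero_apply]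
      ring
    rw [this, dotProduct_zero]
  have hx1 := mul_nonneg hs (hRn x (hK0 x hx))
  have hy1 := mul_nonneg ht (hRn y (hK0 y hy))
  have hx2 := hexp x
  have hy2 := hexp y
  change eval (s • x + t • y) P.objective ≤ s * eval x P.objective + t * eval y P.objective
  set z := eval (s • x + t • y) P.objective
  have hz : z = s * z + t * z := by rw [← add_mul, hst, one_mul]
  rw [hx2, hy2]
  simp only [mul_add]
  linarith

theorem exists_isMinimizer (hconv : ∀ i, IsCopSOSConvex (P.f i)) (hne : P.feasibleSet.Nonempty)
    {b : ℝ} (hb : ∀ x ∈ P.feasibleSet, b ≤ eval x P.objective) : ∃ x, P.IsMinimizer x := by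
  let a : (Fin m₁ ⊕ Fin m₁) ⊕ (Fin m₂ ⊕ Fin n) → (Fin n → ℝ) →ₗ[ℝ] ℝ :=
    Sum.elim (Sum.elim (fun r => LinearMap.proj r ∘ₗ P.A.mulVecLin)
      (fun r => -(LinearMap.proj r ∘ₗ P.A.mulVecLin)))
      (Sum.elim (fun r => LinearMap.proj r ∘ₗ P.C.mulVecLin) LinearMap.proj)
  let β : (Fin m₁ ⊕ Fin m₁) ⊕ (Fin m₂ ⊕ Fin n) → ℝ :=
    Sum.elim (Sum.elim P.b (-P.b)) (Sum.elim P.d 0)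
  have hK : P.feasibleSet = {x | ∀ i, β i ≤ (a i).toContinuousLinearMap x} := by
    ext x
    simp only [feasibleSet, Set.mem_ofPred_eq, Sum.forall, LinearMap.coe_toContinuousLinearMap', a,
      β, Sum.elim_inl, Sum.elim_inr, LinearMap.comp_apply, LinearMap.neg_apply,
      LinearMap.proj_apply, Matrix.mulVecLin_apply, Pi.neg_apply, neg_le_neg_iff, Pi.zero_apply,
      ← forall_and, Pi.le_def]
    constructor
    · rintro ⟨h1, h2⟩
      exact ⟨fun r => ⟨h1 ▸ le_rfl, h1 ▸ le_rfl⟩, fun r => h2.1 r, fun j => h2.2 j⟩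
    · rintro ⟨h1, h3, h4⟩
      exact ⟨funext fun r => le_antisymm (h1 r).2 (h1 r).1, h3, h4⟩
  have hconvex : Convex ℝ P.feasibleSet := by
    rw [hK, Set.ofPred_forall]
    exact convex_iInter fun i => convex_halfSpace_ge (a i).isLinear _
  obtain ⟨x, hx, hmin⟩ := exists_isMinOn_of_convexOn_polyhedron _ β hK P.objective
    (convexOn_objective hconv hconvex fun x hx => hx.2.2) hne hb
  exact ⟨x, hx, hmin⟩

theorem eventually_add_smul_mem_feasibleSet {u v : Fin n → ℝ} (hu : u ∈ P.feasibleSet)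
    (hA : P.A.mulVec v = 0) (hC : ∀ r, P.C.mulVec u r = P.d r → 0 ≤ P.C.mulVec v r)
    (h0 : ∀ j, u j = 0 → 0 ≤ v j) : ∀ᶠ t : ℝ in 𝓝[>] 0, u + t • v ∈ P.feasibleSet := by
  have key : ∀ a b c : ℝ, c ≤ a → (a = c → 0 ≤ b) → ∀ᶠ t : ℝ in 𝓝[>] 0, c ≤ a + t * b := by
    intro a b c hca hb
    rcases hca.eq_or_lt with h | h
    · filter_upwards [self_mem_nhdsWithin] with t ht
      have := mul_nonneg (le_of_lt ht) (hb h.symm)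
      linarith
    · have hc : Tendsto (fun t : ℝ => a + t * b) (𝓝[>] 0) (𝓝 (a + 0 * b)) :=
        (Continuous.tendsto (by fun_prop) 0).mono_left nhdsWithin_le_nhds
      rw [zero_mul, add_zero] at hc
      exact hc.eventually (le_mem_nhds h)
  filter_upwards [eventually_all.mpr fun r => key _ _ _ (hu.2.1 r) (hC r),
    eventually_all.mpr fun j => key _ _ _ (hu.2.2 j) (h0 j)] with t h1 h2
  refine ⟨?_, fun r => ?_, fun j => h2 j⟩
  · rw [Matrix.mulVec_add, Matrix.mulVec_smul, hA, smul_zero, add_zero, hu.1]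
  · rw [Matrix.mulVec_add, Matrix.mulVec_smul]; exact h1 r

/-- Karush–Kuhn–Tucker conditions, in the form of a certificate in the sparse quadratic module. -/
theorem exists_multipliers (hconv : ∀ i, IsCopSOSConvex (P.f i)) {u : Fin n → ℝ}
    (hu : P.IsMinimizer u) : ∃ (lam : Fin m₁ → ℝ) (mu : Fin m₂ → ℝ), 0 ≤ mu ∧
      P.objective - P.g lam mu - MvPolynomial.C (eval u P.objective) ∈ P.sparseModule := by
  classical
  obtain ⟨huK, hmin⟩ := hu
  obtain ⟨c, R, hR, hexp, hB⟩ := exists_supporting hconv huK.2.2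
  -- First-order optimality: along a feasible direction `f(u + t v) - f(u) = t (t B(t) + c ⬝ᵥ v) ≥
  -- 0`; divide by `t` and let `t → 0⁺`.
  have hdir : ∀ v : Fin n → ℝ, P.A.mulVec v = 0 →
      (∀ r, P.C.mulVec u r = P.d r → 0 ≤ P.C.mulVec v r) → (∀ j, u j = 0 → 0 ≤ v j) →
      0 ≤ c ⬝ᵥ v := by
    intro v hA hC h0
    obtain ⟨B, hBc, hBt⟩ := hB v
    have hlim : Tendsto (fun t : ℝ => t * B t + c ⬝ᵥ v) (𝓝[>] 0) (𝓝 (0 * B 0 + c ⬝ᵥ v)) :=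
      (Continuous.tendsto (by fun_prop) 0).mono_left nhdsWithin_le_nhds
    rw [zero_mul, zero_add] at hlim
    refine ge_of_tendsto hlim ?_
    filter_upwards [eventually_add_smul_mem_feasibleSet huK hA hC h0, self_mem_nhdsWithin]
      with t ht hpos
    have h1 : eval u P.objective ≤ eval (u + t • v) P.objective := hmin ht
    rw [hexp (u + t • v), hBt, add_sub_cancel_left, dotProduct_smul, smul_eq_mul] at h1
    have h2 : 0 ≤ t * (t * B t + c ⬝ᵥ v) := by linarith
    exact nonneg_of_mul_nonneg_right h2 hpos
  -- Equations count as two opposite inequalities. Inactive constraints become the zero functional,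
  -- which builds in complementary slackness.
  let a : (Fin m₁ ⊕ Fin m₁) ⊕ (Fin m₂ ⊕ Fin n) → (Fin n → ℝ) →ₗ[ℝ] ℝ :=
    Sum.elim (Sum.elim (fun r => LinearMap.proj r ∘ₗ P.A.mulVecLin)
      (fun r => -(LinearMap.proj r ∘ₗ P.A.mulVecLin)))
      (Sum.elim (fun r => if P.C.mulVec u r = P.d r then
        LinearMap.proj r ∘ₗ P.C.mulVecLin else 0)
        (fun j => if u j = 0 then LinearMap.proj j else 0))
  obtain ⟨w, hw, hc⟩ := exists_eq_sum_of_forall_nonneg Finset.univ a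
    (∑ j, c j • LinearMap.proj j) (fun v hv => by
      simp only [LinearMap.sum_apply, LinearMap.smul_apply, LinearMap.proj_apply, smul_eq_mul]
      refine hdir v (funext fun r => le_antisymm ?_ ?_) (fun r hr => ?_) fun j hj => ?_
      · simpa [a] using hv (.inl (.inr r)) (Finset.mem_univ _)
      · simpa [a] using hv (.inl (.inl r)) (Finset.mem_univ _)
      · simpa [a, hr] using hv (.inr (.inl r)) (Finset.mem_univ _)
      · simpa [a, hj] using hv (.inr (.inr j)) (Finset.mem_univ _))
  set lam : Fin m₁ → ℝ := fun r => w (.inl (.inl r)) - w (.inl (.inr r)) with hlam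
  set mu : Fin m₂ → ℝ := fun r => if P.C.mulVec u r = P.d r then w (.inr (.inl r)) else 0 with hmu
  set nu : Fin n → ℝ := fun j => if u j = 0 then w (.inr (.inr j)) else 0 with hnu
  have hmu0 : 0 ≤ mu := fun r => by
    simp only [hmu, Pi.zero_apply]; split_ifs; exacts [hw _, le_rfl]
  have hnu0 : 0 ≤ nu := fun j => by
    simp only [hnu, Pi.zero_apply]; split_ifs; exacts [hw _, le_rfl]
  have hcx : ∀ x, c ⬝ᵥ x = lam ⬝ᵥ P.A.mulVec x + mu ⬝ᵥ P.C.mulVec x + nu ⬝ᵥ x := by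
    intro x
    have h := LinearMap.congr_fun hc x
    simp only [LinearMap.sum_apply, LinearMap.smul_apply, LinearMap.proj_apply, smul_eq_mul,
      LinearMap.add_apply, Fintype.sum_sum_type, a, Sum.elim_inl, Sum.elim_inr, LinearMap.neg_apply,
      LinearMap.comp_apply, Matrix.mulVecLin_apply] at h
    rw [dotProduct, h]
    simp only [dotProduct, hlam, hmu, hnu, sub_mul, Finset.sum_sub_distrib, mul_neg,
      Finset.sum_neg_distrib, ite_mul, zero_mul]
    rw [← sub_eq_add_neg, add_assoc (_ - _)]
    congr 2 <;>
    · refine Finset.sum_congr rfl fun r _ => ?_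
      split_ifs <;> simp
  have hmuz : mu ⬝ᵥ (P.C.mulVec u - P.d) = 0 := Finset.sum_eq_zero fun r _ => by
    simp only [hmu, Pi.sub_apply]
    split_ifs with h
    · rw [h, sub_self, mul_zero]
    · rw [zero_mul]
  have hnuz : nu ⬝ᵥ u = 0 := Finset.sum_eq_zero fun j _ => by
    simp only [hnu]
    split_ifs with h
    · rw [h, mul_zero]
    · rw [zero_mul]
  refine ⟨lam, mu, hmu0, ?_⟩
  have heq : P.objective - P.g lam mu - MvPolynomial.C (eval u P.objective) =
      R + ∑ j, MvPolynomial.C (nu j) * X j := by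
    refine MvPolynomial.funext fun x => ?_
    have hsum : eval x (∑ j, MvPolynomial.C (nu j) * X j) = nu ⬝ᵥ x := by
      simp [dotProduct]
    rw [map_sub, map_sub, map_add, eval_C, hexp x, eval_g, hsum, dotProduct_sub c, hcx x, hcx u,
      hnuz, ← huK.1]
    simp only [dotProduct_sub] at hmuz ⊢
    linarith
  rw [heq]
  exact add_mem hR (sum_mem fun j _ => P.C_mul_X_mem_sparseModule (hnu0 j) j)

/-! ### The sparse SOS relaxation -/

/-- Weak duality: on the feasible set `g ≥ 0`, and the certificate is nonnegative there. -/
theorem le_eval_objective_of_mem_sosFeasibleSet {k : ℕ} {w : ℝ × (Fin m₁ → ℝ) × (Fin m₂ → ℝ)}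
    (hw : w ∈ P.sosFeasibleSet k) {x : Fin n → ℝ} (hx : x ∈ P.feasibleSet) :
    w.1 ≤ eval x P.objective := by
  have h := P.orthantNonneg_of_mem_sparseModule (P.mem_sparseModule_of_mem_sparseQmod hw.2) x
    hx.2.2
  rw [map_sub, map_sub, eval_C, eval_g, hx.1, sub_self, dotProduct_zero, zero_add] at h
  have h2 : 0 ≤ w.2.2 ⬝ᵥ (P.C.mulVec x - P.d) :=
    dotProduct_nonneg_of_nonneg hw.1 (sub_nonneg.mpr hx.2.1)
  linarith

theorem totalDegree_lagrangian_le {k : ℕ} (hk : P.k₀ ≤ k) (hk1 : 1 ≤ k) (lam : Fin m₁ → ℝ)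
    (mu : Fin m₂ → ℝ) (γ : ℝ) :
    (P.objective - P.g lam mu - MvPolynomial.C γ).totalDegree ≤ 2 * k := by
  have h1 := totalDegree_g_le (P := P) lam mu
  have h2 := totalDegree_sub (P.objective - P.g lam mu) (MvPolynomial.C γ)
  have h3 := totalDegree_sub P.objective (P.g lam mu)
  rw [totalDegree_C] at h2
  rw [k₀] at hk
  omega

theorem fspa_eq_fmin (hconv : ∀ i, IsCopSOSConvex (P.f i)) {k : ℕ} (hk : P.k₀ ≤ k)
    (hk1 : 1 ≤ k) (hne : P.feasibleSet.Nonempty) : P.fspa k = P.fmin := by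
  refine le_antisymm (iSup₂_le fun w hw => le_iInf₂ fun x hx =>
    EReal.coe_le_coe_iff.mpr (le_eval_objective_of_mem_sosFeasibleSet hw hx)) ?_
  by_cases hbot : P.fmin = ⊥
  · rw [hbot]; exact bot_le
  obtain ⟨x₀, hx₀⟩ := hne
  have hle : ∀ x ∈ P.feasibleSet, P.fmin ≤ (eval x P.objective : ℝ) := fun x hx => iInf₂_le x hx
  have htop : P.fmin ≠ ⊤ := ((hle x₀ hx₀).trans_lt (EReal.coe_lt_top _)).ne
  obtain ⟨u, hu⟩ := exists_isMinimizer hconv ⟨x₀, hx₀⟩ (b := P.fmin.toReal) fun x hx => by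
    rw [← EReal.coe_le_coe_iff, EReal.coe_toReal htop hbot]
    exact hle x hx
  obtain ⟨lam, mu, hmu, hmem⟩ := exists_multipliers hconv hu
  have hfeas : (eval u P.objective, lam, mu) ∈ P.sosFeasibleSet k :=
    ⟨hmu, P.mem_sparseQmod_of_mem_sparseModule hmem (totalDegree_lagrangian_le hk hk1 _ _ _)⟩
  exact (hle u hu.1).trans (le_iSup₂_of_le (f := fun (w : ℝ × (Fin m₁ → ℝ) × (Fin m₂ → ℝ))
    (_ : w ∈ P.sosFeasibleSet k) => ((w.1 : ℝ) : EReal)) _ hfeas le_rfl)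

theorem coe_eq_fspa {k : ℕ} {γ : ℝ} {lam : Fin m₁ → ℝ} {mu : Fin m₂ → ℝ}
    (h : P.IsSOSOptimizer k (γ, lam, mu)) : (γ : EReal) = P.fspa k :=
  le_antisymm (le_iSup₂_of_le (f := fun (w : ℝ × (Fin m₁ → ℝ) × (Fin m₂ → ℝ))
      (_ : w ∈ P.sosFeasibleSet k) => ((w.1 : ℝ) : EReal)) _ h.1 le_rfl)
    (iSup₂_le fun _ hw => EReal.coe_le_coe_iff.mpr (h.2 hw))

theorem lagrangian_mem_sparseQmod {k : ℕ} {x : Fin n → ℝ} (hx : P.IsStrictlyFeasible x) {γ : ℝ} {lam : Fin m₁ → ℝ} {mu : Fin m₂ → ℝ}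
    (hw : (γ, lam, mu) ∈ P.sosFeasibleSet k) (hγ : (γ : EReal) = P.fmin) :
    P.objective - P.g lam mu - MvPolynomial.C γ ∈ P.sparseQmod P.k₀ := by
  have hmem := P.mem_sparseModule_of_mem_sparseQmod hw.2
  refine P.mem_sparseQmod_of_mem_sparseModule hmem ?_
  by_cases hk₀ : 1 ≤ P.k₀
  · exact totalDegree_lagrangian_le le_rfl hk₀ _ _ _
  -- If `k₀ = 0` the affine `g` could exceed degree `2k₀`. But `f` is then a constant `a ≤ γ`, and
  -- the Lagrangian is affine, nonnegative on the orthant and nonpositive at the interior point `x`,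
  -- hence constant.
  have hdeg : P.objective.totalDegree = 0 := by rw [k₀] at hk₀; omega
  obtain ⟨a, ha⟩ : ∃ a, P.objective = MvPolynomial.C a :=
    ⟨_, totalDegree_eq_zero_iff_eq_C.mp hdeg⟩
  have haγ : a ≤ γ := by
    rw [← EReal.coe_le_coe_iff, hγ]
    exact le_iInf₂ fun y _ => by rw [ha, eval_C]
  refine ((P.orthantNonneg_of_mem_sparseModule hmem).totalDegree_eq_zero ?_ hx.2.2 ?_).le.trans
    (Nat.zero_le _)
  · have h1 := totalDegree_g_le (P := P) lam mu
    have h2 := totalDegree_sub (P.objective - P.g lam mu) (MvPolynomial.C γ)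
    have h3 := totalDegree_sub P.objective (P.g lam mu)
    rw [totalDegree_C] at h2
    change (P.objective - P.g lam mu - MvPolynomial.C γ).totalDegree ≤ 1
    omega
  · have h2 : 0 ≤ mu ⬝ᵥ (P.C.mulVec x - P.d) :=
      dotProduct_nonneg_of_nonneg hw.1 (sub_nonneg.mpr fun r => (hx.2.1 r).le)
    change eval x (P.objective - P.g lam mu - MvPolynomial.C γ) ≤ 0
    rw [map_sub, map_sub, eval_C, eval_g, ha, eval_C, hx.1, sub_self, dotProduct_zero]
    linarith

end Problem

end SparseCop

/-! ### Tightness of both relaxations -/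

theorem mainTheorem1 {n m m₁ m₂ : ℕ} (hm : 0 < m) (P : SparseCop.Problem n m m₁ m₂)
    (hconv : ∀ i, SparseCop.IsCopSOSConvex (P.f i))
    (k : ℕ) (hk : P.k₀ ≤ k) (hk1 : 1 ≤ k) :
    P.fsmo k = P.fmin ∧
    (∀ y : P.labels k → ℝ, P.IsMomentOptimizer k y → P.IsMinimizer (P.proj y)) ∧
    ((∃ x, P.IsStrictlyFeasible x) →
      P.fspa k = P.fmin ∧
      ∀ (γ : ℝ) (lam : Fin m₁ → ℝ) (mu : Fin m₂ → ℝ), P.IsSOSOptimizer k (γ, lam, mu) →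
        (γ : EReal) = P.fmin ∧
        P.objective - P.g lam mu - MvPolynomial.C P.fmin.toReal ∈ P.sparseQmod P.k₀) := by
  refine ⟨SparseCop.Problem.fsmo_eq_fmin hm hconv hk hk1,
    fun y hy => SparseCop.Problem.isMinimizer_proj hm hconv hk hk1 hy, ?_⟩
  rintro ⟨x, hx⟩
  have hspa := SparseCop.Problem.fspa_eq_fmin hconv hk hk1
    ⟨x, hx.1, fun r => (hx.2.1 r).le, fun j => (hx.2.2 j).le⟩
  refine ⟨hspa, fun γ lam mu hw => ?_⟩
  have hγ : (γ : EReal) = P.fmin := (SparseCop.Problem.coe_eq_fspa hw).trans hspa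
  refine ⟨hγ, ?_⟩
  rw [← hγ, EReal.toReal_coe]
  exact SparseCop.Problem.lagrangian_mem_sparseQmod hx hw.1 hγ
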